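/- Let $G$ be a finite plane graph (loops, multiple edges, isolated nodes and several components are allowed) with $N$ nodes, let $Q\ge 1$ be an integer and $K\in\mathbb C$; put $v=e^{K}-1$. The $Q$-state Potts partition function is $P_G=\sum_\sigma e^{K E(\sigma)}$, where $\sigma$ runs over the maps from the nodes of $G$ to $\{1,\dots,Q\}$ and $E(\sigma)$ is the number of edges whose two end-nodes receive the same value. Let $K(G)$ be the link diagram on the medial graph of $G$: one crossing on each edge, one arc in each corner, one crossingless circle around each isolated node, with crossings chosen so that smoothing along an edge (joining the regions of its end-nodes) is the $B$-smoothing. For a diagram $D$, a state $S$ is the set of crossings that receive a $B$-smoothing (all others receive an $A$-smoothing), $|S|$ is its number of elements and $\ell(S)$ its number of loops. For a square root $\sqrt Q\in\mathbb C$ of $Q$ (either one) put $$\{D\}=\sum_S (Q^{-1/2}v)^{|S|}\,(\sqrt Q)^{\ell(S)},\qquad [D](q,\rho)=\sum_S(-q\rho)^{|S|}(q+q^{-1})^{\ell(S)} .$$ An enhanced state $s$ is a state with a label $1$ or $X$ on each loop; $n_B(s)$ is its number of $B$-smoothings, $\lambda(s)$ the number of loops labelled $1$ minus the number labelled $X$,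 and $j(s)=n_B(s)+\lambda(s)$. Let $R$ be an integral domain, e.g. $\mathbb Z/2$ or $\mathbb Z$, and let $\mathcal C^{ij}$ be the free $R$-module on the enhanced states with $n_B=i$, $j(s)=j$. The Khovanov differential $\partial$ is the signed sum, over all $A$-sites, of the partial differentials that turn the site into a $B$-site and relabel by $1\cdot1=1$, $1\cdot X=X\cdot 1=X$, $X\cdot X=0$ when two loops merge, and by $\Delta(1)=1\otimes X+X\otimes 1$, $\Delta(X)=X\otimes X$ when a loop splits; the signs come from an ordering of the crossings. Let $H^{ij}$ be its homology, $\chi(H^{\bullet j})=\sum_i(-1)^i\operatorname{rank}H^{ij}$ and $\chi_\rho(\mathcal C^{\bullet j})=\sum_i(-\rho)^i\operatorname{rank}\mathcal C^{ij}$. For $D=K(G)$ the following hold. 1. $K(G)$ is a planar alternating diagram, $\partial$ maps $\mathcal C^{ij}$ into $\mathcal C^{i+1,j}$ and $\partial^2=0$. 2. $P_G=Q^{N/2}\{K(G)\}$, where $Q^{N/2}=(\sqrt Q)^N$, for either square root of $Q$. 3. For all $q\ne0$ and $\rho$ in $\mathbb C$: $[K(G)](q,\rho)=\sum_s(-\rho)^{n_B(s)}q^{j(s)}=\sum_j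 q^j\chi_\rho(\mathcal C^{\bullet j})$, the last sum having finitely many non-zero terms. 4. For every choice of $\sqrt Q$ there are $q\neq 0$ and $\rho$ in $\mathbb C$ with $$-q\rho=Q^{-1/2}v,\qquad q+q^{-1}=\sqrt Q .\qquad(*)$$ Whenever $(*)$ holds, $\{K(G)\}=[K(G)](q,\rho)$ and $P_G=Q^{N/2}\sum_jq^j\chi_\rho(\mathcal C^{\bullet j})$; moreover $q=\frac{\sqrt Q+w}{2}$ and $q^{-1}=\frac{\sqrt Q-w}2$ for some $w$ with $w^2=Q-4$, and $\rho=v\,\frac{-1+u}{2}$ for some $u$ with $u^2=1-4/Q$. 5. $\chi_1(\mathcal C^{\bullet j})=\chi(H^{\bullet j})$ for all $j$. If $G$ has at least one edge then, for $\rho\in\mathbb C$, the coefficients $\chi_\rho(\mathcal C^{\bullet j})$ equal the Euler characteristics $\chi(H^{\bullet j})$ for all $j$ if and only if $\rho=1$. If $(*)$ holds with $\rho=1$, then $P_G=Q^{N/2}\sum_jq^j\chi(H^{\bullet j})$. 6. $(*)$ can be satisfied with $\rho=1$ (for some choice of $\sqrt Q$ and $q$) if and only if $e^K=\frac{2-Q-rw}{2}$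 for some $r,w$ with $r^2=Q$, $w^2=Q-4$. For $Q=2$ this is the case if and only if $e^K=\pm i$; for $Q=3$ if and only if $e^K=\frac{-1\pm\sqrt3\,i}{2}$; for $Q=4$ if and only if $e^K=-1$; and for $Q>4$ it implies that $e^K$ is real and negative. In all cases of $\rho=1$, $K$ is not real, and if $K=J/(kT)$ with $J=\pm1$ and $k>0$ real then the temperature $T$ is not real. 7. (Criticality.) $(*)$ can be satisfied with $\rho=1$ and $-\rho q=1$ (for some choice of $\sqrt Q$ and $q$) if and only if $Q=4$ and $e^K=-1$; in that case necessarily $\sqrt Q=-2$, $q=-1$ and $K=(2n+1)i\pi$ for some integer $n$. -/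

import Mathlib

noncomputable section

/-! ### Link diagrams, smoothings, loops, enhanced states -/

/-- A link diagram with set of crossings `X` and set of crossingless circles `C`.
The four half-arcs at a crossing `c` are `(c,0), (c,1), (c,2), (c,3)` in counterclockwise order;
the strand through `(c,0)` and `(c,2)` passes under the strand through `(c,1)` and `(c,3)`.
The map `arc` sends a half-arc to the half-arc at the other end of the same arc. -/
structure LinkDiagram (X C : Type*) where
  arc : X × Fin 4 → X × Fin 4
  arc_arc : ∀ h, arc (arc h) = h
  arc_ne : ∀ h, arc h ≠ h

/-- The labels `1` and `X` of loops in an enhanced state. -/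
inductive LoopLabel
  | one
  | X
  deriving DecidableEq

namespace LoopLabel

instance : Fintype LoopLabel := ⟨{one, X}, fun a => by cases a <;> decide⟩

/-- Multiplication of the basis `1, X` of `k[X]/(X²)`; `none` stands for `X * X = 0`. -/
def mul : LoopLabel → LoopLabel → Option LoopLabel
  | one, one => some one
  | one, X => some X
  | X, one => some X
  | X, X => none

/-- The basis tensors in `Δ(1) = 1 ⊗ X + X ⊗ 1` and in `Δ(X) = X ⊗ X`. -/
def comul : LoopLabel → Set (LoopLabel × LoopLabel)
  | one => {(one, X), (X, one)}
  | X => {(X, X)}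

end LoopLabel

namespace LinkDiagram

variable {X C : Type*} (D : LinkDiagram X C)

/-- The arcs join over-passing ends to under-passing ends. -/
def IsAlternating : Prop :=
  ∀ h, ((D.arc h).2 = 1 ∨ (D.arc h).2 = 3) ↔ ¬ (h.2 = 1 ∨ h.2 = 3)

/-- The regions bounded by the arcs of the projection (one for each boundary walk). -/
def Region : Type _ :=
  Quotient (Relation.EqvGen.setoid fun a b : X × Fin 4 => b = ((D.arc a).1, (D.arc a).2 + 1))

/-- The connected components of the projection that contain a crossing. -/
def ProjectionComponent : Type _ :=
  Quotient (Relation.EqvGen.setoid fun a b : X × Fin 4 => b = D.arc a ∨ b.1 = a.1)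

/-- The projection is a plane `4`-valent graph: Euler's formula `V - E + F = 2c`, with `V` crossings
and `E = 2 V` arcs. (Euler's formula in this total form forces genus `0` for every component.) -/
def IsPlanar : Prop :=
  Nat.card X + Nat.card D.Region = 2 * Nat.card X + 2 * Nat.card D.ProjectionComponent

/-- A state is the set `S` of crossings that carry a `B`-smoothing. The `A`-smoothing at a crossing
joins `0` to `1` and `2` to `3` (it opens the two regions swept by the over-strand when it is turned
counterclockwise); the `B`-smoothing joins `1` to `2` and `3` to `0`. -/
def smoothing [DecidableEq X] (S : Finset X) (h : X × Fin 4) : X × Fin 4 :=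
  (h.1, (if h.1 ∈ S then 3 else 1) - h.2)

variable [DecidableEq X]

/-- Two half-arcs lie on the same loop of the state `S`. -/
def loopSetoid (S : Finset X) : Setoid (X × Fin 4) :=
  Relation.EqvGen.setoid fun a b => b = D.arc a ∨ b = smoothing S a

/-- The loops of the state `S`, the crossingless circles included. -/
def Loop (S : Finset X) : Type _ := Quotient (D.loopSetoid S) ⊕ C

/-- The loop of the state `S` through a half-arc. -/
def loopAt (S : Finset X) (h : X × Fin 4) : D.Loop S := Sum.inl (Quotient.mk (D.loopSetoid S) h)

/-- The loop of the state `S` given by a crossingless circle. -/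
def loopCircle (S : Finset X) (c : C) : D.Loop S := Sum.inr c

instance [Finite X] [Finite C] (S : Finset X) : Finite (D.Loop S) :=
  inferInstanceAs (Finite (Quotient (D.loopSetoid S) ⊕ C))

/-- The state sum of the bracket in which a crossing equals its `A`-smoothing plus `b` times its
`B`-smoothing, and in which a loop has the value `δ`. -/
def bracket [Fintype X] (b δ : ℂ) : ℂ :=
  ∑ S : Finset X, b ^ S.card * δ ^ Nat.card (D.Loop S)

/-- The `ρ`-bracket: a crossing is `A`-smoothing minus `qρ` times `B`-smoothing, a loop is
`q + q⁻¹`. -/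
def rhoBracket [Fintype X] (q ρ : ℂ) : ℂ := D.bracket (-(q * ρ)) (q + q⁻¹)

/-- Enhanced states: a state together with a label on each of its loops. -/
def EnhancedState : Type _ := Σ S : Finset X, (D.Loop S → LoopLabel)

instance [Finite X] [Finite C] : Finite D.EnhancedState :=
  inferInstanceAs (Finite (Σ S : Finset X, (D.Loop S → LoopLabel)))

instance [Finite X] [Finite C] : Fintype D.EnhancedState := Fintype.ofFinite _

variable {D}

/-- `n_B(s)`, the number of `B`-smoothings. -/
def EnhancedState.nB (s : D.EnhancedState) : ℕ := s.1.card

/-- `λ(s)`, the number of loops labelled `1` minus the number of loops labelled `X`. -/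
def EnhancedState.lam (s : D.EnhancedState) : ℤ :=
  (Nat.card {l // s.2 l = LoopLabel.one} : ℤ) - (Nat.card {l // s.2 l = LoopLabel.X} : ℤ)

/-- `j(s) = n_B(s) + λ(s)`. -/
def EnhancedState.jdeg (s : D.EnhancedState) : ℤ := (s.nB : ℤ) + s.lam

/-- The label of the loop through a half-arc. -/
def EnhancedState.labelAt (s : D.EnhancedState) (h : X × Fin 4) : LoopLabel :=
  s.2 (D.loopAt s.1 h)

variable (D)

/-- The enhanced state `s'` occurs in the partial differential `∂_τ(s)`: the site `τ` is of type `A`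
in `s`, it is resmoothed to type `B`, loops that do not pass through `τ` keep their labels, and at
`τ` either two loops merge and the labels are multiplied, or one loop splits in two and its label is
comultiplied. (The two local strands at `τ` are those through `(τ,0)` and `(τ,2)`, for either
smoothing.) -/
def IsPartialTerm (τ : X) (s s' : D.EnhancedState) : Prop :=
  τ ∉ s.1 ∧ s'.1 = insert τ s.1 ∧
  (∀ h, (∀ k, D.loopAt s.1 h ≠ D.loopAt s.1 (τ, k)) → s'.labelAt h = s.labelAt h) ∧
  (∀ c : C, s'.2 (D.loopCircle s'.1 c) = s.2 (D.loopCircle s.1 c)) ∧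
  ((D.loopAt s.1 (τ, 0) ≠ D.loopAt s.1 (τ, 2) ∧ D.loopAt s'.1 (τ, 0) = D.loopAt s'.1 (τ, 2) ∧
      LoopLabel.mul (s.labelAt (τ, 0)) (s.labelAt (τ, 2)) = some (s'.labelAt (τ, 0))) ∨
    (D.loopAt s.1 (τ, 0) = D.loopAt s.1 (τ, 2) ∧ D.loopAt s'.1 (τ, 0) ≠ D.loopAt s'.1 (τ, 2) ∧
      (s'.labelAt (τ, 0), s'.labelAt (τ, 2)) ∈ LoopLabel.comul (s.labelAt (τ, 0))))

end LinkDiagram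

/-! ### The Khovanov complex over a commutative ring -/

namespace LinkDiagram

variable {X C : Type*} [Fintype X] [LinearOrder X] [Finite C]
variable (R : Type*) [CommRing R] (D : LinkDiagram X C)

/-- The chain module: the free module on the (finitely many) enhanced states; a function `f` stands
for the chain `∑_s f(s) s`. -/
abbrev Chain : Type _ := D.EnhancedState → R

open Classical in
/-- The coefficient of `s'` in `∂(s) = ∑_τ ± ∂_τ(s)`; the sign is that of `dx_τ ∧ dx_S` where `S` is
the (ordered) set of `B`-sites of `s`. Over `ℤ/2` the signs are immaterial. -/
def incidence (s s' : D.EnhancedState) : R :=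
  ∑ τ : X, if D.IsPartialTerm τ s s' then (-1 : R) ^ (s.1.filter fun σ => σ < τ).card else 0

/-- The Khovanov differential. -/
def differential : D.Chain R →ₗ[R] D.Chain R where
  toFun f s' := ∑ s : D.EnhancedState, f s * D.incidence R s s'
  map_add' f g := by
    funext s'
    simp [add_mul, Finset.sum_add_distrib]
  map_smul' a f := by
    funext s'
    simp [mul_assoc, Finset.mul_sum]

/-- `C^{ij}`: the chains that involve only enhanced states with `n_B(s) = i` and `j(s) = j`. -/
def chainGroup (i j : ℤ) : Submodule R (D.Chain R) where
  carrier := {f | ∀ s : D.EnhancedState, ¬ ((s.nB : ℤ) = i ∧ s.jdeg = j) → f s = 0}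
  add_mem' hf hg s hs := by simp [hf s hs, hg s hs]
  zero_mem' _ _ := rfl
  smul_mem' a f hf s hs := by simp [hf s hs]

/-- The cycles in `C^{ij}`. -/
def cycles (i j : ℤ) : Submodule R (D.Chain R) :=
  D.chainGroup R i j ⊓ LinearMap.ker (D.differential R)

/-- The image of `C^{i-1,j}`. -/
def boundaries (i j : ℤ) : Submodule R (D.Chain R) :=
  (D.chainGroup R (i - 1) j).map (D.differential R)

/-- The Khovanov homology `H^{ij}`: cycles modulo boundaries. -/
abbrev Homology (i j : ℤ) : Type _ :=
  D.cycles R i j ⧸ (D.boundaries R i j).submoduleOf (D.cycles R i j)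

/-- The generalized Euler characteristic `χ_ρ(C^{•j}) = ∑_i (-ρ)^i dim C^{ij}`; note that
`C^{ij} = 0` unless `0 ≤ i ≤ #crossings`. -/
def chiRho (ρ : ℂ) (j : ℤ) : ℂ :=
  ∑ i ∈ Finset.range (Fintype.card X + 1),
    (-ρ) ^ i * (Module.finrank R (D.chainGroup R (i : ℤ) j) : ℂ)

/-- The Euler characteristic `χ(H^{•j}) = ∑_i (-1)^i rank H^{ij}` of Khovanov homology. -/
def chiHomology (j : ℤ) : ℤ :=
  ∑ i ∈ Finset.range (Fintype.card X + 1),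
    (-1 : ℤ) ^ i * (Module.finrank R (D.Homology R (i : ℤ) j) : ℤ)

end LinkDiagram

/-! ### Plane graphs, their link diagrams and the Potts model -/

/-- Reversal of darts. A dart is an edge with one of its two ends. -/
def dartFlip (E : Type*) : Equiv.Perm (E × Bool) :=
  Equiv.prodCongr (Equiv.refl E) Equiv.boolNot

/-- A plane graph (loops, multiple edges, isolated nodes and several components are allowed) as a
combinatorial map: `vert d` is the node from which the dart `d` issues, `rot d` is the next dart
counterclockwise around that node, and every component has genus `0`, which is Euler's formula
`V - E + F = 2c` for the part of the graph without its isolated nodes. -/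
structure PlaneGraph (V E : Type*) where
  vert : E × Bool → V
  rot : Equiv.Perm (E × Bool)
  sameCycle_iff : ∀ d d', rot.SameCycle d d' ↔ vert d = vert d'
  euler : Nat.card (Quotient (Equiv.Perm.SameCycle.setoid rot)) +
      Nat.card (Quotient (Equiv.Perm.SameCycle.setoid (rot * dartFlip E))) =
    Nat.card E + 2 * Nat.card (Quotient (Relation.EqvGen.setoid
      fun d d' : E × Bool => d' = rot d ∨ d' = dartFlip E d))

namespace PlaneGraph

variable {V E : Type*} (G : PlaneGraph V E)

/-- The nodes without edges. -/
abbrev IsolatedNode : Type _ := {x : V // ∀ d, G.vert d ≠ x}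

/-- The half-arc of the medial diagram on the left side of a dart (seen from its node). -/
def leftSide (d : E × Bool) : E × Fin 4 := (d.1, if d.2 then 2 else 0)

/-- The half-arc of the medial diagram on the right side of a dart (seen from its node). -/
def rightSide (d : E × Bool) : E × Fin 4 := (d.1, if d.2 then 3 else 1)

/-- The arcs of the medial diagram: one in each corner between a dart `d` and the next dart `rot d`,
from the left side of `d` to the right side of `rot d`. -/
def medialArc : E × Fin 4 → E × Fin 4
  | (e, 0) => rightSide (G.rot (e, false))
  | (e, 1) => leftSide (G.rot.symm (e, false))
  | (e, 2) => rightSide (G.rot (e, true))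
  | (e, 3) => leftSide (G.rot.symm (e, true))

theorem medialArc_leftSide (d : E × Bool) : G.medialArc (leftSide d) = rightSide (G.rot d) := by
  obtain ⟨e, b⟩ := d
  cases b <;> rfl

theorem medialArc_rightSide (d : E × Bool) :
    G.medialArc (rightSide d) = leftSide (G.rot.symm d) := by
  obtain ⟨e, b⟩ := d
  cases b <;> rfl

theorem exists_side (h : E × Fin 4) : (∃ d, h = leftSide d) ∨ ∃ d, h = rightSide d := by
  obtain ⟨e, k⟩ := h
  fin_cases k
  · exact Or.inl ⟨(e, false), rfl⟩
  · exact Or.inr ⟨(e, false), rfl⟩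
  · exact Or.inl ⟨(e, true), rfl⟩
  · exact Or.inr ⟨(e, true), rfl⟩

theorem leftSide_ne_rightSide (d d' : E × Bool) : leftSide d ≠ rightSide d' := by
  obtain ⟨e, b⟩ := d
  obtain ⟨e', b'⟩ := d'
  cases b <;> cases b' <;> simp [leftSide, rightSide]

/-- The link diagram `K(G)` on the medial graph: a crossing on each edge, with the crossing type for
which smoothing along the edge (which joins the regions of the two end-nodes) is the `B`-smoothing,
and a crossingless circle around each isolated node. -/
def linkDiagram : LinkDiagram E G.IsolatedNode where
  arc := G.medialArc
  arc_arc h := by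
    rcases exists_side h with ⟨d, rfl⟩ | ⟨d, rfl⟩
    · simp [medialArc_leftSide, medialArc_rightSide]
    · simp [medialArc_leftSide, medialArc_rightSide]
  arc_ne h := by
    rcases exists_side h with ⟨d, rfl⟩ | ⟨d, rfl⟩
    · rw [medialArc_leftSide]
      exact (leftSide_ne_rightSide _ _).symm
    · rw [medialArc_rightSide]
      exact leftSide_ne_rightSide _ _

/-- The energy of a spin state: the number of edges whose end-nodes receive the same spin. -/
def energy [Fintype E] {Q : ℕ} (σ : V → Fin Q) : ℕ :=
  (Finset.univ.filter fun e : E => σ (G.vert (e, false)) = σ (G.vert (e, true))).card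

/-- The partition function `P_G = ∑_σ e^{K E(σ)}` of the `Q`-state Potts model. -/
def potts [Fintype V] [DecidableEq V] [Fintype E] (Q : ℕ) (K : ℂ) : ℂ :=
  ∑ σ : V → Fin Q, Complex.exp (K * (G.energy σ : ℂ))

end PlaneGraph

/-- `q, ρ` are the variables of the `ρ`-bracket that correspond to the `Q`-state Potts model with
parameter `K`, where `r` is the chosen (complex) square root of `Q`:
`-qρ = Q^{-1/2} v` and `q + q⁻¹ = Q^{1/2}`, with `v = e^K - 1`. -/
structure IsPottsParam (Q : ℕ) (K r q ρ : ℂ) : Prop where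
  sq_root : r ^ 2 = (Q : ℂ)
  q_ne : q ≠ 0
  loop_value : q + q⁻¹ = r
  site_value : -(q * ρ) = r⁻¹ * (Complex.exp K - 1)

end

/-! The Potts identity rests on a count of loops. Writing e^{KE(σ)} as a product over the edges of 1
+ v·[the ends agree] and expanding gives P_G = ∑_S v^{|S|} Q^{k(S)}, where k(S) is the number of
components of the spanning subgraph S (`sum_pow_energy`). Euler's formula for spanning subgraphs,
ℓ(S) + N = 2k(S) + |S| (`card_loop_add_card`), then turns each summand into the corresponding
summand of the bracket.

This formula comes from permutations. A loop of a state alternates between left and right sides of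
darts, so the loops of S that meet a crossing are the cycles of `rot⁻¹` times the reversal of the
darts on S. Adding an edge to S multiplies by a transposition, so exactly two loops merge or exactly
one loop splits (`mergesOrSplits`). Hence 2k(S) + |S| − N − ℓ(S), twice the genus, never decreases
when an edge is added. It is 0 for the empty set and, by Euler's formula for G, for the full edge
set, so it is 0 throughout.

The Khovanov part needs nothing of the diagram but `MergesOrSplits`. Every enhanced state is
obtained from a unit (all labels 1) by multiplying by X on some loops, and the unsigned partial
differentials commute with these multiplications (`partialDiff_mulX`). Identities between them need
only be checked on units (`ext_unitChain`): there a merge sends the unit to the unit, and a split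
sends it to the unit times the sum of the two X's. Two sites commute on units by a short case list
of merges and splits; the signs turn this into ∂² = 0. That j is preserved is likewise reduced to
units, where it is the change of the loop number by one.

Summing over the two labels of each loop gives q + q⁻¹, which expands the ρ-bracket by the degree j.
Rank-nullity over a domain and a telescoping sum identify the coefficients at ρ = 1 with Euler
characteristics of homology (`chiRho_one`). Conversely, equality of all coefficients makes the
brackets at ρ and at 1 agree for every q ≠ 0. At q + q⁻¹ = 1 a bracket is (1 − qρ)^{|E|}, and the
two such q confine ρ to two circles that meet only in 0 and 1; the value 0 is excluded by a strict
inequality between 5-state Potts sums (`eq_one_of_rhoBracket_eq`).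

The statements on temperatures follow from the fact that ρ = 1 amounts to e^K = −q² (`one_iff`). -/

/-! ### Identifying two points of a quotient -/

/-- The setoid obtained from `s` by identifying the classes of `a` and `b`. -/
def Setoid.joinPair {α : Type*} (s : Setoid α) (a b : α) : Setoid α where
  r x y := s x y ∨ (s x a ∧ s b y) ∨ (s x b ∧ s a y)
  iseqv := by
    have hs : ∀ {x y}, s x y → s y x := fun h => s.symm' h
    have ht : ∀ {x y z}, s x y → s y z → s x z := fun h h' => s.trans' h h'
    refine ⟨fun x => Or.inl (s.refl' x), ?_, ?_⟩
    · rintro x y (h | ⟨h, h'⟩ | ⟨h, h'⟩)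
      · exact Or.inl (hs h)
      · exact Or.inr (Or.inr ⟨hs h', hs h⟩)
      · exact Or.inr (Or.inl ⟨hs h', hs h⟩)
    · rintro x y z (h | ⟨h, h'⟩ | ⟨h, h'⟩) (k | ⟨k, k'⟩ | ⟨k, k'⟩)
      · exact Or.inl (ht h k)
      · exact Or.inr (Or.inl ⟨ht h k, k'⟩)
      · exact Or.inr (Or.inr ⟨ht h k, k'⟩)
      · exact Or.inr (Or.inl ⟨h, ht h' k⟩)
      · exact Or.inr (Or.inl ⟨h, k'⟩)
      · exact Or.inl (ht h k')
      · exact Or.inr (Or.inr ⟨h, ht h' k⟩)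
      · exact Or.inl (ht h k')
      · exact Or.inr (Or.inr ⟨h, k'⟩)

namespace Setoid

variable {α : Type*} {s t : Setoid α} {a b : α}

theorem le_joinPair : s ≤ s.joinPair a b := fun _ _ h => Or.inl h

theorem joinPair_self : s.joinPair a b a b := Or.inr (Or.inl ⟨s.refl' a, s.refl' b⟩)

theorem joinPair_le (h : s ≤ t) (hab : t a b) : s.joinPair a b ≤ t := by
  rintro x y (k | ⟨k, k'⟩ | ⟨k, k'⟩)
  · exact h k
  · exact t.trans' (h k) (t.trans' hab (h k'))
  · exact t.trans' (h k) (t.trans' (t.symm' hab) (h k'))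

theorem joinPair_eq_self (h : s a b) : s.joinPair a b = s :=
  le_antisymm (joinPair_le le_rfl h) le_joinPair

/-- The old classes other than that of `b` correspond bijectively to the new classes: the class of
`a` absorbs that of `b`, and nothing else changes. -/
theorem card_quotient_joinPair [Finite α] (h : ¬ s a b) :
    Nat.card (Quotient (s.joinPair a b)) + 1 = Nat.card (Quotient s) := by
  classical
  have hs : ∀ {x y}, s x y → s y x := fun h => s.symm' h
  have ht : ∀ {x y z}, s x y → s y z → s x z := fun h h' => s.trans' h h'
  let f : {c : Quotient s // c ≠ Quotient.mk s b} → Quotient (s.joinPair a b) := fun c =>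
    Quotient.map' id (fun _ _ h => le_joinPair h) c.1
  have hf : Function.Bijective f := by
    constructor
    · rintro ⟨c, hc⟩ ⟨d, hd⟩ hcd
      induction c using Quotient.inductionOn with | _ x
      induction d using Quotient.inductionOn with | _ y
      have hx : ¬ s x b := fun k => hc (Quotient.sound k)
      have hy : ¬ s b y := fun k => hd (Quotient.sound (hs k))
      have : s.joinPair a b x y := Quotient.exact hcd
      rcases this with k | ⟨_, k⟩ | ⟨k, _⟩
      · exact Subtype.ext (Quotient.sound k)
      · exact absurd k hy
      · exact absurd k hx
    · intro c
      induction c using Quotient.inductionOn with | _ x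
      by_cases hx : s x b
      · exact ⟨⟨Quotient.mk s a, fun k => h (Quotient.exact k)⟩,
          Quotient.sound (Or.inr (Or.inl ⟨s.refl' a, hs hx⟩))⟩
      · exact ⟨⟨Quotient.mk s x, fun k => hx (Quotient.exact k)⟩,
          Quotient.sound ((s.joinPair a b).refl' x)⟩
  rw [← Nat.card_congr (Equiv.ofBijective f hf), ← Finite.card_option]
  exact Nat.card_congr (Equiv.optionSubtypeNe (Quotient.mk s b))

end Setoid

/-! ### Cycles of a permutation times a transposition -/

namespace Equiv.Perm

variable {α : Type*} [DecidableEq α] {f : Perm α} {a b : α}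

/-- The new permutation sends `a` to `f b` and then follows the old cycle of `b`, which avoids `a`,
until it comes back to `b`. -/
theorem sameCycle_mul_swap_of_not_sameCycle [Finite α] (h : ¬ f.SameCycle a b) :
    (f * Equiv.swap a b).SameCycle a b := by
  set g := f * Equiv.swap a b with hg
  obtain ⟨n, hn, hfn⟩ : ∃ n : ℕ, 0 < n ∧ (f ^ n) b = b :=
    ⟨orderOf f, orderOf_pos f, by simp [pow_orderOf_eq_one]⟩
  have key : ∀ m : ℕ, g.SameCycle a ((f ^ (m + 1)) b) := by
    intro m
    induction m with
    | zero => exact ⟨1, by simp [hg]⟩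
    | succ m ih =>
      by_cases hb : (f ^ (m + 1)) b = b
      · rw [pow_succ', mul_apply, hb]
        exact ⟨1, by simp [hg]⟩
      · have ha : (f ^ (m + 1)) b ≠ a := fun k =>
          h (SameCycle.symm ⟨((m + 1 : ℕ) : ℤ), by rw [zpow_natCast]; exact k⟩)
        refine ih.trans ⟨1, ?_⟩
        rw [zpow_one, hg, mul_apply, Equiv.swap_apply_of_ne_of_ne ha hb, ← mul_apply, ← pow_succ']
  obtain ⟨m, rfl⟩ : ∃ m, n = m + 1 := ⟨n - 1, by omega⟩
  simpa [hfn] using key m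

/-- If n is least with `(f ^ n) a = b`, the new permutation sends `b` to `f a`, so the new cycle of
`b` stays in {f a, …, fⁿ a = b}, which does not contain `a`. -/
theorem not_sameCycle_mul_swap_of_sameCycle [Finite α] (hab : a ≠ b) (h : f.SameCycle a b) :
    ¬ (f * Equiv.swap a b).SameCycle a b := by
  classical
  have hex : ∃ n : ℕ, (f ^ n) a = b := by
    obtain ⟨n, _, hn⟩ := h.exists_pow_eq'
    exact ⟨n, hn⟩
  set n := Nat.find hex with hn
  have hfn : (f ^ n) a = b := Nat.find_spec hex
  have hmin : ∀ m < n, (f ^ m) a ≠ b := fun m hm => Nat.find_min hex hm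
  have hn0 : 0 < n := by
    rcases Nat.eq_zero_or_pos n with h0 | h0
    · rw [h0] at hfn; exact absurd hfn hab
    · exact h0
  set g := f * Equiv.swap a b with hg
  have hne : ∀ i, 1 ≤ i → i ≤ n → (f ^ i) a ≠ a := by
    intro i hi hin k
    -- A return to `a` after i steps would let `b` be reached i steps earlier, against the
    -- minimality of `n`.
    have : (f ^ (n - i)) a = b := by
      rw [← hfn]
      conv_rhs => rw [← Nat.sub_add_cancel hin, pow_add, mul_apply, k]
    exact hmin (n - i) (by omega) this
  have key : ∀ m : ℕ, ∃ i, 1 ≤ i ∧ i ≤ n ∧ (g ^ m) b = (f ^ i) a := by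
    intro m
    induction m with
    | zero => exact ⟨n, hn0, le_rfl, by simp [hfn]⟩
    | succ m ih =>
      obtain ⟨i, hi, hin, hm⟩ := ih
      rw [pow_succ', mul_apply, hm]
      rcases hin.lt_or_eq with hlt | rfl
      · refine ⟨i + 1, by omega, by omega, ?_⟩
        rw [hg, mul_apply, Equiv.swap_apply_of_ne_of_ne (hne i hi hin) (hmin i hlt), ← mul_apply,
          ← pow_succ']
      · exact ⟨1, le_rfl, hn0, by rw [hfn]; simp [hg]⟩
  intro hc
  obtain ⟨m, _, hm⟩ := hc.symm.exists_pow_eq'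
  obtain ⟨i, hi, hin, h'⟩ := key m
  exact hne i hi hin (h' ▸ hm)

theorem sameCycle_mul_swap_iff [Finite α] (hab : a ≠ b) :
    (f * Equiv.swap a b).SameCycle a b ↔ ¬ f.SameCycle a b :=
  ⟨fun h h' => not_sameCycle_mul_swap_of_sameCycle hab h' h, sameCycle_mul_swap_of_not_sameCycle⟩

end Equiv.Perm

/-! ### Loops of adjacent states -/

namespace LinkDiagram

variable {X C : Type*} [DecidableEq X] (D : LinkDiagram X C)

theorem loopSetoid_arc (S : Finset X) (h : X × Fin 4) : D.loopSetoid S h (D.arc h) :=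
  Relation.EqvGen.rel _ _ (Or.inl rfl)

theorem loopSetoid_smoothing (S : Finset X) (h : X × Fin 4) :
    D.loopSetoid S h (smoothing S h) :=
  Relation.EqvGen.rel _ _ (Or.inr rfl)

theorem loopSetoid_le {S : Finset X} {t : Setoid (X × Fin 4)} (h₁ : ∀ h, t h (D.arc h))
    (h₂ : ∀ h, t h (smoothing S h)) : D.loopSetoid S ≤ t := by
  refine Setoid.eqvGen_le ?_
  rintro x y (rfl | rfl)
  · exact h₁ x
  · exact h₂ x

theorem loopSetoid_zero_one {S : Finset X} {τ : X} (h : τ ∉ S) :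
    D.loopSetoid S (τ, 0) (τ, 1) := by
  simpa [smoothing, h] using D.loopSetoid_smoothing S (τ, 0)

theorem loopSetoid_two_three {S : Finset X} {τ : X} (h : τ ∉ S) :
    D.loopSetoid S (τ, 2) (τ, 3) := by
  simpa [smoothing, h, show (1 : Fin 4) - 2 = 3 from rfl] using D.loopSetoid_smoothing S (τ, 2)

theorem loopSetoid_zero_three {S : Finset X} {τ : X} (h : τ ∈ S) :
    D.loopSetoid S (τ, 0) (τ, 3) := by
  simpa [smoothing, h] using D.loopSetoid_smoothing S (τ, 0)

theorem loopSetoid_two_one {S : Finset X} {τ : X} (h : τ ∈ S) :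
    D.loopSetoid S (τ, 2) (τ, 1) := by
  simpa [smoothing, h, show (3 : Fin 4) - 2 = 1 from rfl] using D.loopSetoid_smoothing S (τ, 2)

/-- Every half-arc at a crossing lies on the loop through `0` or on the loop through `2`. -/
theorem loopSetoid_crossing (S : Finset X) (τ : X) (k : Fin 4) :
    D.loopSetoid S (τ, k) (τ, 0) ∨ D.loopSetoid S (τ, k) (τ, 2) := by
  by_cases h : τ ∈ S
  · have h₁ := D.loopSetoid_zero_three h
    have h₂ := D.loopSetoid_two_one h
    fin_cases k
    · exact Or.inl (Setoid.refl' _ _)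
    · exact Or.inr (Setoid.symm' _ h₂)
    · exact Or.inr (Setoid.refl' _ _)
    · exact Or.inl (Setoid.symm' _ h₁)
  · have h₁ := D.loopSetoid_zero_one h
    have h₂ := D.loopSetoid_two_three h
    fin_cases k
    · exact Or.inl (Setoid.refl' _ _)
    · exact Or.inl (Setoid.symm' _ h₁)
    · exact Or.inr (Setoid.refl' _ _)
    · exact Or.inr (Setoid.symm' _ h₂)

/-- Away from `τ` the two states have the same smoothings. At `τ` all four half-arcs lie on the
strand through 0 or on the strand through 2, so once these are joined the smoothing there is
immaterial. -/
theorem loopSetoid_le_joinPair {S T : Finset X} {τ : X} (hST : ∀ x, x ≠ τ → (x ∈ S ↔ x ∈ T)) :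
    D.loopSetoid S ≤ (D.loopSetoid T).joinPair (τ, 0) (τ, 2) := by
  refine D.loopSetoid_le (fun h => Or.inl (D.loopSetoid_arc T h)) ?_
  rintro ⟨x, k⟩
  by_cases hx : x = τ
  · subst hx
    set t := (D.loopSetoid T).joinPair (x, 0) (x, 2)
    have h02 : t (x, 0) (x, 2) := Setoid.joinPair_self
    have key : ∀ k, t (x, k) (x, 0) := by
      intro k
      rcases D.loopSetoid_crossing T x k with h | h
      · exact Or.inl h
      · exact t.trans' (Setoid.le_joinPair h) (t.symm' h02)
    exact t.trans' (key k) (t.symm' (key _))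
  · have : smoothing S (x, k) = smoothing T (x, k) := by simp [smoothing, hST x hx]
    rw [this]
    exact Or.inl (D.loopSetoid_smoothing T _)

theorem joinPair_loopSetoid_insert (S : Finset X) (τ : X) :
    (D.loopSetoid (insert τ S)).joinPair (τ, 0) (τ, 2) =
      (D.loopSetoid S).joinPair (τ, 0) (τ, 2) :=
  le_antisymm
    (Setoid.joinPair_le (D.loopSetoid_le_joinPair fun x hx => by simp [hx]) Setoid.joinPair_self)
    (Setoid.joinPair_le (D.loopSetoid_le_joinPair fun x hx => by simp [hx]) Setoid.joinPair_self)

/-- Whenever a site is resmoothed, two loops merge or a loop splits. -/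
def MergesOrSplits : Prop :=
  ∀ (S : Finset X) (τ : X), τ ∉ S →
    (D.loopSetoid (insert τ S) (τ, 0) (τ, 2) ↔ ¬ D.loopSetoid S (τ, 0) (τ, 2))

variable {D}

theorem MergesOrSplits.of_merge (hD : D.MergesOrSplits) {S : Finset X} {τ : X} (hτ : τ ∉ S)
    (h : ¬ D.loopSetoid S (τ, 0) (τ, 2)) :
    D.loopSetoid (insert τ S) = (D.loopSetoid S).joinPair (τ, 0) (τ, 2) := by
  rw [← joinPair_loopSetoid_insert, Setoid.joinPair_eq_self ((hD S τ hτ).2 h)]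

theorem of_split {S : Finset X} {τ : X} (h : D.loopSetoid S (τ, 0) (τ, 2)) :
    D.loopSetoid S = (D.loopSetoid (insert τ S)).joinPair (τ, 0) (τ, 2) := by
  rw [joinPair_loopSetoid_insert, Setoid.joinPair_eq_self h]

variable [Finite X] [Finite C]

theorem card_loop (D : LinkDiagram X C) (S : Finset X) :
    Nat.card (D.Loop S) = Nat.card (Quotient (D.loopSetoid S)) + Nat.card C :=
  Nat.card_sum

theorem MergesOrSplits.card_loop_of_merge (hD : D.MergesOrSplits) {S : Finset X} {τ : X}
    (hτ : τ ∉ S) (h : ¬ D.loopSetoid S (τ, 0) (τ, 2)) :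
    Nat.card (D.Loop (insert τ S)) + 1 = Nat.card (D.Loop S) := by
  rw [card_loop, card_loop, hD.of_merge hτ h, ← Setoid.card_quotient_joinPair h]
  omega

theorem MergesOrSplits.card_loop_of_split (hD : D.MergesOrSplits) {S : Finset X} {τ : X}
    (hτ : τ ∉ S) (h : D.loopSetoid S (τ, 0) (τ, 2)) :
    Nat.card (D.Loop (insert τ S)) = Nat.card (D.Loop S) + 1 := by
  have h' : ¬ D.loopSetoid (insert τ S) (τ, 0) (τ, 2) := fun k => (hD S τ hτ).1 k h
  rw [card_loop, card_loop, of_split h, ← Setoid.card_quotient_joinPair h']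
  omega

end LinkDiagram

/-! ### Loops of the states of `K(G)` -/

theorem Equiv.Perm.SameCycle.le_setoid {α : Type*} {f : Equiv.Perm α} {t : Setoid α}
    (h : ∀ x, t x (f x)) : Equiv.Perm.SameCycle.setoid f ≤ t := by
  rintro x y ⟨n, rfl⟩
  induction n using Int.induction_on with
  | zero => exact t.refl' _
  | succ n ih =>
    refine t.trans' ih ?_
    rw [add_comm, zpow_add, zpow_one, Equiv.Perm.mul_apply]
    exact h _
  | pred n ih =>
    refine t.trans' ih (t.symm' ?_)
    have := h ((f ^ (-(n : ℤ) - 1)) x)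
    rwa [← Equiv.Perm.mul_apply, ← zpow_one_add, add_sub_cancel] at this

/-- A map that respects and reflects two setoids and meets every class identifies the quotients. -/
noncomputable def Quotient.congrOfSurjective {α β : Type*} {s : Setoid α} {t : Setoid β} (f : α → β)
    (hf : ∀ x y, s x y ↔ t (f x) (f y)) (hs : ∀ y, ∃ x, t (f x) y) : Quotient s ≃ Quotient t :=
  Equiv.ofBijective (Quotient.map f fun x y h => (hf x y).1 h) <| by
    constructor
    · intro c d h
      induction c using Quotient.inductionOn with | _ x
      induction d using Quotient.inductionOn with | _ y
      exact Quotient.sound ((hf x y).2 (Quotient.exact h))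
    · intro c
      induction c using Quotient.inductionOn with | _ y
      obtain ⟨x, hx⟩ := hs y
      exact ⟨Quotient.mk s x, Quotient.sound hx⟩

namespace PlaneGraph

variable {V E : Type*} (G : PlaneGraph V E)

/-- The dart at whose side a half-arc of the medial diagram lies. -/
def sideDart (h : E × Fin 4) : E × Bool := (h.1, decide (h.2 = 2 ∨ h.2 = 3))

@[simp] theorem sideDart_leftSide (d : E × Bool) : sideDart (leftSide d) = d := by
  obtain ⟨e, b⟩ := d
  cases b <;> rfl

@[simp] theorem sideDart_rightSide (d : E × Bool) : sideDart (rightSide d) = d := by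
  obtain ⟨e, b⟩ := d
  cases b <;> rfl

theorem dartFlip_dartFlip (d : E × Bool) : dartFlip E (dartFlip E d) = d := by
  obtain ⟨e, b⟩ := d
  cases b <;> rfl

theorem arc_leftSide (d : E × Bool) : G.linkDiagram.arc (leftSide d) = rightSide (G.rot d) :=
  G.medialArc_leftSide d

theorem arc_rightSide (d : E × Bool) :
    G.linkDiagram.arc (rightSide d) = leftSide (G.rot.symm d) :=
  G.medialArc_rightSide d

/-- The dart that represents a half-arc on its loop. -/
def loopDart (h : E × Fin 4) : E × Bool :=
  if h.2 = 0 ∨ h.2 = 2 then sideDart h else G.rot.symm (sideDart h)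

theorem loopDart_leftSide (d : E × Bool) : G.loopDart (leftSide d) = d := by
  have : (leftSide d).2 = 0 ∨ (leftSide d).2 = 2 := by
    obtain ⟨e, b⟩ := d
    cases b <;> simp [leftSide]
  rw [loopDart, if_pos this, sideDart_leftSide]

theorem loopDart_rightSide (d : E × Bool) : G.loopDart (rightSide d) = G.rot.symm d := by
  have : ¬ ((rightSide d).2 = 0 ∨ (rightSide d).2 = 2) := by
    obtain ⟨e, b⟩ := d
    cases b <;> simp [rightSide]
  rw [loopDart, if_neg this, sideDart_rightSide]

section Loops

variable [DecidableEq E] (S : Finset E)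

/-- Reversal of the darts on the edges in `S`. -/
def flipOn : Equiv.Perm (E × Bool) where
  toFun d := if d.1 ∈ S then dartFlip E d else d
  invFun d := if d.1 ∈ S then dartFlip E d else d
  left_inv d := by
    by_cases h : d.1 ∈ S
    · have : (dartFlip E d).1 ∈ S := h
      simp [h, this, dartFlip_dartFlip]
    · simp [h]
  right_inv d := by
    by_cases h : d.1 ∈ S
    · have : (dartFlip E d).1 ∈ S := h
      simp [h, this, dartFlip_dartFlip]
    · simp [h]

theorem flipOn_apply (d : E × Bool) : flipOn S d = if d.1 ∈ S then dartFlip E d else d := rfl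

theorem flipOn_flipOn (d : E × Bool) : flipOn S (flipOn S d) = d := (flipOn S).left_inv d

theorem flipOn_empty : flipOn (∅ : Finset E) = 1 := by
  ext d <;> simp [flipOn_apply]

theorem flipOn_univ [Fintype E] : flipOn (Finset.univ : Finset E) = dartFlip E := by
  ext d <;> simp [flipOn_apply]

theorem flipOn_insert {τ : E} (h : τ ∉ S) :
    flipOn (insert τ S) = flipOn S * Equiv.swap (τ, false) (τ, true) := by
  refine Equiv.ext fun d => ?_
  obtain ⟨e, b⟩ := d
  by_cases he : e = τ
  · subst he
    cases b <;> simp [flipOn_apply, h, dartFlip]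
  · have h₁ : ∀ b', (e, b) ≠ (τ, b') := fun b' k => he (congrArg Prod.fst k)
    rw [Equiv.Perm.mul_apply, Equiv.swap_apply_of_ne_of_ne (h₁ _) (h₁ _)]
    simp [flipOn_apply, he]

theorem smoothing_leftSide (d : E × Bool) :
    LinkDiagram.smoothing S (leftSide d) = rightSide (flipOn S d) := by
  obtain ⟨e, b⟩ := d
  by_cases h : e ∈ S <;> cases b <;>
    simp [LinkDiagram.smoothing, leftSide, rightSide, flipOn_apply, h, dartFlip]

theorem smoothing_rightSide (d : E × Bool) :
    LinkDiagram.smoothing S (rightSide d) = leftSide (flipOn S d) := by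
  obtain ⟨e, b⟩ := d
  by_cases h : e ∈ S <;> cases b <;>
    simp [LinkDiagram.smoothing, leftSide, rightSide, flipOn_apply, h, dartFlip]

/-- The permutation of the darts whose cycles are the loops of the state `S`. -/
def loopPerm : Equiv.Perm (E × Bool) := G.rot⁻¹ * flipOn S

theorem loopPerm_apply (d : E × Bool) : G.loopPerm S d = G.rot.symm (flipOn S d) := rfl

/-- Passing along an arc leaves the representing dart unchanged; passing through a smoothing moves
it one step forwards or backwards along `loopPerm`. -/
theorem sameCycle_loopDart {h h' : E × Fin 4} (hh : G.linkDiagram.loopSetoid S h h') :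
    (G.loopPerm S).SameCycle (G.loopDart h) (G.loopDart h') := by
  have key : G.linkDiagram.loopSetoid S ≤
      (Equiv.Perm.SameCycle.setoid (G.loopPerm S)).comap G.loopDart := by
    refine G.linkDiagram.loopSetoid_le ?_ ?_
    · intro h
      change (G.loopPerm S).SameCycle _ _
      rcases exists_side h with ⟨d, rfl⟩ | ⟨d, rfl⟩
      · rw [arc_leftSide, loopDart_leftSide, loopDart_rightSide, Equiv.symm_apply_apply]
      · rw [arc_rightSide, loopDart_leftSide, loopDart_rightSide]
    · intro h
      change (G.loopPerm S).SameCycle _ _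
      rcases exists_side h with ⟨d, rfl⟩ | ⟨d, rfl⟩
      · rw [smoothing_leftSide, loopDart_leftSide, loopDart_rightSide, ← loopPerm_apply]
        exact ⟨1, by simp⟩
      · rw [smoothing_rightSide, loopDart_leftSide, loopDart_rightSide]
        refine Equiv.Perm.SameCycle.symm ⟨1, ?_⟩
        rw [zpow_one, loopPerm_apply, flipOn_flipOn]
  exact key hh

theorem loopSetoid_leftSide_loopPerm (d : E × Bool) :
    G.linkDiagram.loopSetoid S (leftSide d) (leftSide (G.loopPerm S d)) := by
  have h₁ := G.linkDiagram.loopSetoid_smoothing S (leftSide d)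
  have h₂ := G.linkDiagram.loopSetoid_arc S (LinkDiagram.smoothing S (leftSide d))
  rw [smoothing_leftSide] at h₁ h₂
  rw [arc_rightSide] at h₂
  exact Setoid.trans' _ h₁ h₂

theorem loopSetoid_leftSide_iff (d d' : E × Bool) :
    G.linkDiagram.loopSetoid S (leftSide d) (leftSide d') ↔ (G.loopPerm S).SameCycle d d' := by
  constructor
  · intro h
    simpa only [loopDart_leftSide] using G.sameCycle_loopDart S h
  · exact fun h => Equiv.Perm.SameCycle.le_setoid
      (t := (G.linkDiagram.loopSetoid S).comap leftSide) (G.loopSetoid_leftSide_loopPerm S) h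

theorem card_quotient_loopSetoid : Nat.card (Quotient (G.linkDiagram.loopSetoid S)) =
    Nat.card (Quotient (Equiv.Perm.SameCycle.setoid (G.loopPerm S))) := by
  refine (Nat.card_congr (Quotient.congrOfSurjective leftSide
    (fun d d' => (G.loopSetoid_leftSide_iff S d d').symm) fun h => ?_)).symm
  rcases exists_side h with ⟨d, rfl⟩ | ⟨d, rfl⟩
  · exact ⟨d, Setoid.refl' _ _⟩
  · refine ⟨G.rot.symm d, ?_⟩
    rw [← arc_rightSide]
    exact Setoid.symm' _ (G.linkDiagram.loopSetoid_arc S _)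

/-- Since left sides alternate with right sides, loops are cycles of a permutation of darts, and
resmoothing `τ` multiplies it by the transposition of the two darts on `τ`. A transposition joins
two cycles or cuts one; a loop can never be rearranged into a single loop. -/
theorem mergesOrSplits [Finite E] : G.linkDiagram.MergesOrSplits := by
  intro S τ hτ
  have h₀ : ((τ, 0) : E × Fin 4) = leftSide (τ, false) := rfl
  have h₂ : ((τ, 2) : E × Fin 4) = leftSide (τ, true) := rfl
  rw [h₀, h₂, loopSetoid_leftSide_iff, loopSetoid_leftSide_iff, loopPerm, loopPerm,
    flipOn_insert S hτ, ← mul_assoc]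
  exact Equiv.Perm.sameCycle_mul_swap_iff (by simp)

end Loops

/-! ### Planarity -/

theorem isAlternating : G.linkDiagram.IsAlternating := by
  intro h
  have hl : ∀ d : E × Bool, ¬ ((leftSide d).2 = 1 ∨ (leftSide d).2 = 3) := by
    rintro ⟨e, b⟩
    cases b <;> simp [leftSide]
  have hr : ∀ d : E × Bool, (rightSide d).2 = 1 ∨ (rightSide d).2 = 3 := by
    rintro ⟨e, b⟩
    cases b <;> simp [rightSide]
  rcases exists_side h with ⟨d, rfl⟩ | ⟨d, rfl⟩
  · rw [arc_leftSide]
    exact iff_of_true (hr _) (hl _)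
  · rw [arc_rightSide]
    exact iff_of_false (hl _) (not_not.2 (hr _))

/-- The setoid whose classes are the components of `G` that contain an edge. -/
def dartComponent : Setoid (E × Bool) :=
  Relation.EqvGen.setoid fun d d' : E × Bool => d' = G.rot d ∨ d' = dartFlip E d

theorem dartComponent_le {t : Setoid (E × Bool)} (h₁ : ∀ d, t d (G.rot d))
    (h₂ : ∀ d, t d (dartFlip E d)) : G.dartComponent ≤ t := by
  refine Setoid.eqvGen_le ?_
  rintro x y (rfl | rfl)
  · exact h₁ x
  · exact h₂ x

theorem dartComponent_rot (d : E × Bool) : G.dartComponent d (G.rot d) :=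
  Relation.EqvGen.rel _ _ (Or.inl rfl)

theorem dartComponent_flip (d : E × Bool) : G.dartComponent d (dartFlip E d) :=
  Relation.EqvGen.rel _ _ (Or.inr rfl)

theorem card_projectionComponent :
    Nat.card G.linkDiagram.ProjectionComponent = Nat.card (Quotient G.dartComponent) := by
  set t : Setoid (E × Fin 4) := Relation.EqvGen.setoid
    fun a b : E × Fin 4 => b = G.linkDiagram.arc a ∨ b.1 = a.1 with ht
  have harc : ∀ a, t a (G.linkDiagram.arc a) := fun a => Relation.EqvGen.rel _ _ (Or.inl rfl)
  have hfst : ∀ a b : E × Fin 4, b.1 = a.1 → t a b := fun a b h =>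
    Relation.EqvGen.rel _ _ (Or.inr h)
  have h₁ : t ≤ G.dartComponent.comap sideDart := by
    refine Setoid.eqvGen_le ?_
    rintro x y (rfl | h)
    · change G.dartComponent _ _
      rcases exists_side x with ⟨d, rfl⟩ | ⟨d, rfl⟩
      · rw [arc_leftSide, sideDart_leftSide, sideDart_rightSide]
        exact G.dartComponent_rot d
      · rw [arc_rightSide, sideDart_leftSide, sideDart_rightSide]
        simpa using Setoid.symm' _ (G.dartComponent_rot (G.rot.symm d))
    · change G.dartComponent _ _
      obtain ⟨e, k⟩ := x
      obtain ⟨e', k'⟩ := y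
      obtain rfl : e' = e := h
      have key : ∀ b b', G.dartComponent (e', b) (e', b') := by
        intro b b'
        cases b <;> cases b'
        · exact Setoid.refl' _ _
        · exact G.dartComponent_flip (e', false)
        · exact G.dartComponent_flip (e', true)
        · exact Setoid.refl' _ _
      exact key _ _
  have h₂ : G.dartComponent ≤ t.comap leftSide := by
    refine G.dartComponent_le (fun d => ?_) fun d => hfst _ _ rfl
    change t _ _
    refine t.trans' (harc _) ?_
    rw [arc_leftSide]
    exact hfst _ _ rfl
  refine (Nat.card_congr (Quotient.congrOfSurjective (t := t) leftSide (fun d d' => ⟨fun h => h₂ h,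
    fun h => by simpa [Setoid.comap_rel] using h₁ h⟩) fun h => ⟨(h.1, false), hfst _ _ rfl⟩)).symm

theorem region_leftSide (d : E × Bool) : ((G.linkDiagram.arc (leftSide d)).1,
    (G.linkDiagram.arc (leftSide d)).2 + 1) = leftSide (dartFlip E (G.rot d)) := by
  rw [arc_leftSide]
  obtain ⟨e, b⟩ := G.rot d
  cases b
  · rfl
  · simp [rightSide, leftSide, dartFlip]

theorem region_rightSide (d : E × Bool) : ((G.linkDiagram.arc (rightSide d)).1,
    (G.linkDiagram.arc (rightSide d)).2 + 1) = rightSide (G.rot.symm d) := by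
  rw [arc_rightSide]
  obtain ⟨e, b⟩ := G.rot.symm d
  cases b <;> rfl

/-- The region in which a half-arc of the medial diagram lies, as a node or a face of `G`. -/
def nodeOrFace (h : E × Fin 4) : Quotient (Equiv.Perm.SameCycle.setoid G.rot) ⊕
    Quotient (Equiv.Perm.SameCycle.setoid (G.rot * dartFlip E)) :=
  if h.2 = 0 ∨ h.2 = 2 then Sum.inr (Quotient.mk _ (dartFlip E (sideDart h)))
  else Sum.inl (Quotient.mk _ (sideDart h))

theorem nodeOrFace_leftSide (d : E × Bool) :
    G.nodeOrFace (leftSide d) = Sum.inr (Quotient.mk _ (dartFlip E d)) := by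
  obtain ⟨e, b⟩ := d
  cases b <;> rfl

theorem nodeOrFace_rightSide (d : E × Bool) :
    G.nodeOrFace (rightSide d) = Sum.inl (Quotient.mk _ d) := by
  obtain ⟨e, b⟩ := d
  cases b <;> rfl

/-- The setoid whose classes are the regions of the medial diagram. -/
def regionSetoid : Setoid (E × Fin 4) :=
  Relation.EqvGen.setoid fun a b : E × Fin 4 =>
    b = ((G.linkDiagram.arc a).1, (G.linkDiagram.arc a).2 + 1)

/-- The regions of the medial diagram are the nodes with edges and the faces of `G`. -/
def regionEquiv : Quotient G.regionSetoid ≃ Quotient (Equiv.Perm.SameCycle.setoid G.rot) ⊕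
    Quotient (Equiv.Perm.SameCycle.setoid (G.rot * dartFlip E)) where
  toFun := Quotient.lift G.nodeOrFace <| by
    intro a b hab
    have key : G.regionSetoid ≤ Setoid.ker G.nodeOrFace := by
      refine Setoid.eqvGen_le ?_
      rintro x y rfl
      change G.nodeOrFace x = G.nodeOrFace _
      rcases exists_side x with ⟨d, rfl⟩ | ⟨d, rfl⟩
      · rw [region_leftSide, nodeOrFace_leftSide, nodeOrFace_leftSide, dartFlip_dartFlip]
        refine congrArg Sum.inr (Quotient.sound ⟨1, ?_⟩)
        simp [dartFlip_dartFlip]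
      · rw [region_rightSide, nodeOrFace_rightSide, nodeOrFace_rightSide]
        refine congrArg Sum.inl (Quotient.sound ⟨-1, ?_⟩)
        simp [Equiv.Perm.inv_def]
    exact key hab
  invFun := Sum.elim
    (Quotient.map rightSide fun a b hab => by
      refine Equiv.Perm.SameCycle.le_setoid (t := G.regionSetoid.comap rightSide)
        (fun d => Setoid.symm' _ ?_) hab
      refine Relation.EqvGen.rel _ _ ?_
      rw [region_rightSide, Equiv.symm_apply_apply])
    (Quotient.map (fun d => leftSide (dartFlip E d)) fun a b hab => by
      refine Equiv.Perm.SameCycle.le_setoid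
        (t := G.regionSetoid.comap fun d => leftSide (dartFlip E d)) (fun d => ?_) hab
      refine Relation.EqvGen.rel _ _ ?_
      rw [region_leftSide]
      rfl)
  left_inv c := by
    induction c using Quotient.inductionOn with | _ h
    rcases exists_side h with ⟨d, rfl⟩ | ⟨d, rfl⟩
    · rw [Quotient.lift_mk, nodeOrFace_leftSide, Sum.elim_inr, Quotient.map_mk, dartFlip_dartFlip]
    · rw [Quotient.lift_mk, nodeOrFace_rightSide, Sum.elim_inl, Quotient.map_mk]
  right_inv c := by
    rcases c with c | c
    · induction c using Quotient.inductionOn with | _ d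
      rw [Sum.elim_inl, Quotient.map_mk, Quotient.lift_mk, nodeOrFace_rightSide]
    · induction c using Quotient.inductionOn with | _ d
      rw [Sum.elim_inr, Quotient.map_mk, Quotient.lift_mk, nodeOrFace_leftSide, dartFlip_dartFlip]

/-- The regions are the non-isolated nodes and the faces of G, and the components correspond, so
this is Euler's formula for G with the number of edges added to both sides. -/
theorem isPlanar [Finite E] : G.linkDiagram.IsPlanar := by
  have h₁ := G.euler
  have h₂ : Nat.card G.linkDiagram.Region = _ := Nat.card_congr G.regionEquiv
  rw [Nat.card_sum] at h₂
  rw [LinkDiagram.IsPlanar, h₂, h₁, card_projectionComponent, dartComponent]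
  ring

/-! ### Components of spanning subgraphs -/

/-- Two nodes lie in the same component of the spanning subgraph with edge set `S`. -/
def component (S : Finset E) : Setoid V :=
  Relation.EqvGen.setoid fun x y => ∃ e ∈ S, x = G.vert (e, false) ∧ y = G.vert (e, true)

theorem component_edge {S : Finset E} {e : E} (he : e ∈ S) :
    G.component S (G.vert (e, false)) (G.vert (e, true)) :=
  Relation.EqvGen.rel _ _ ⟨e, he, rfl, rfl⟩

theorem component_le {S : Finset E} {t : Setoid V}
    (h : ∀ e ∈ S, t (G.vert (e, false)) (G.vert (e, true))) : G.component S ≤ t := by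
  refine Setoid.eqvGen_le ?_
  rintro x y ⟨e, he, rfl, rfl⟩
  exact h e he

theorem component_empty : G.component ∅ = ⊥ :=
  le_bot_iff.1 (G.component_le (by simp))

theorem component_insert [DecidableEq E] (S : Finset E) (τ : E) : G.component (insert τ S) =
    (G.component S).joinPair (G.vert (τ, false)) (G.vert (τ, true)) := by
  apply le_antisymm
  · refine G.component_le fun e he => ?_
    rcases Finset.mem_insert.1 he with rfl | he
    · exact Setoid.joinPair_self
    · exact Setoid.le_joinPair (G.component_edge he)
  · refine Setoid.joinPair_le (G.component_le fun e he => ?_) ?_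
    · exact G.component_edge (Finset.mem_insert_of_mem he)
    · exact G.component_edge (Finset.mem_insert_self _ _)

theorem vert_rot (d : E × Bool) : G.vert (G.rot d) = G.vert d :=
  ((G.sameCycle_iff _ _).1 ⟨1, by simp⟩).symm

theorem component_flipOn [DecidableEq E] (S : Finset E) (d : E × Bool) :
    G.component S (G.vert d) (G.vert (flipOn S d)) := by
  rw [flipOn_apply]
  obtain ⟨e, b⟩ := d
  split_ifs with h
  · cases b
    · exact G.component_edge h
    · exact Setoid.symm' _ (G.component_edge h)
  · exact Setoid.refl' _ _

theorem component_of_loopSetoid [DecidableEq E] {S : Finset E} {h h' : E × Fin 4}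
    (hh : G.linkDiagram.loopSetoid S h h') :
    G.component S (G.vert (sideDart h)) (G.vert (sideDart h')) := by
  have key : G.linkDiagram.loopSetoid S ≤
      (G.component S).comap fun h => G.vert (sideDart h) := by
    refine G.linkDiagram.loopSetoid_le (fun h => ?_) fun h => ?_
    · rw [Setoid.comap_rel]
      rcases exists_side h with ⟨d, rfl⟩ | ⟨d, rfl⟩
      · rw [arc_leftSide, sideDart_leftSide, sideDart_rightSide, vert_rot]
      · have := G.vert_rot (G.rot.symm d)
        rw [Equiv.apply_symm_apply] at this
        rw [arc_rightSide, sideDart_leftSide, sideDart_rightSide, this]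
    · rw [Setoid.comap_rel]
      rcases exists_side h with ⟨d, rfl⟩ | ⟨d, rfl⟩
      · rw [smoothing_leftSide, sideDart_leftSide, sideDart_rightSide]
        exact G.component_flipOn S d
      · rw [smoothing_rightSide, sideDart_leftSide, sideDart_rightSide]
        exact G.component_flipOn S d
  exact key hh

/-- If `s` is the pull-back to the darts of a setoid `t` on the nodes and every isolated node is
alone in its class, then the classes of `t` are the classes of `s` and the isolated nodes. -/
theorem card_quotient_nodes [Finite V] [Finite E] (s : Setoid (E × Bool)) (t : Setoid V)
    (hst : ∀ d d', s d d' ↔ t (G.vert d) (G.vert d'))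
    (ht : ∀ x y, t x y → (∀ d, G.vert d ≠ x) → x = y) :
    Nat.card (Quotient t) = Nat.card (Quotient s) + Nat.card G.IsolatedNode := by
  rw [← Nat.card_sum]
  refine (Nat.card_congr (Equiv.ofBijective (Sum.elim
    (Quotient.map G.vert fun d d' h => (hst d d').1 h) fun x => Quotient.mk t x.1) ⟨?_, ?_⟩)).symm
  · rintro (c | c) (c' | c') h
    · induction c using Quotient.inductionOn with | _ d
      induction c' using Quotient.inductionOn with | _ d'
      exact congrArg Sum.inl (Quotient.sound ((hst d d').2 (Quotient.exact h)))
    · induction c using Quotient.inductionOn with | _ d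
      have : t (G.vert d) c'.1 := Quotient.exact h
      exact absurd (ht _ _ (t.symm' this) c'.2).symm (c'.2 d)
    · induction c' using Quotient.inductionOn with | _ d
      have : t c.1 (G.vert d) := Quotient.exact h
      exact absurd (ht _ _ this c.2).symm (c.2 d)
    · have : t c.1 c'.1 := Quotient.exact h
      exact congrArg Sum.inr (Subtype.ext (ht _ _ this c.2))
  · intro c
    induction c using Quotient.inductionOn with | _ x
    by_cases hx : ∀ d, G.vert d ≠ x
    · exact ⟨Sum.inr ⟨x, hx⟩, rfl⟩
    · push Not at hx
      obtain ⟨d, rfl⟩ := hx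
      exact ⟨Sum.inl (Quotient.mk _ d), rfl⟩

theorem card_nodes [Finite V] [Finite E] : Nat.card V =
    Nat.card (Quotient (Equiv.Perm.SameCycle.setoid G.rot)) + Nat.card G.IsolatedNode := by
  rw [← G.card_quotient_nodes _ ⊥ G.sameCycle_iff fun x y h _ => h]
  exact Nat.card_congr (Equiv.ofBijective (Quotient.mk ⊥)
    ⟨fun x y h => Quotient.exact h, Quotient.mk_surjective⟩)

/-- Two nodes are equal or have darts in the same component. -/
def dartConnected : Setoid V where
  r x y := x = y ∨ ∃ d d', G.vert d = x ∧ G.vert d' = y ∧ G.dartComponent d d'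
  iseqv := by
    refine ⟨fun x => Or.inl rfl, ?_, ?_⟩
    · rintro x y (rfl | ⟨d, d', rfl, rfl, h⟩)
      · exact Or.inl rfl
      · exact Or.inr ⟨d', d, rfl, rfl, Setoid.symm' _ h⟩
    · rintro x y z (rfl | ⟨d, d', rfl, rfl, h⟩) (rfl | ⟨k, k', hk, rfl, h'⟩)
      · exact Or.inl rfl
      · exact Or.inr ⟨k, k', hk, rfl, h'⟩
      · exact Or.inr ⟨d, d', rfl, rfl, h⟩
      · refine Or.inr ⟨d, k', rfl, rfl, Setoid.trans' _ h (Setoid.trans' _ ?_ h')⟩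
        exact Equiv.Perm.SameCycle.le_setoid G.dartComponent_rot ((G.sameCycle_iff _ _).2 hk.symm)

theorem component_le_dartConnected (S : Finset E) : G.component S ≤ G.dartConnected :=
  G.component_le fun e _ => Or.inr ⟨_, _, rfl, rfl, G.dartComponent_flip (e, false)⟩

/-- Components in `euler` are counted on darts and therefore miss the isolated nodes, which are
added here. -/
theorem card_component_univ [Finite V] [Fintype E] :
    Nat.card (Quotient (G.component Finset.univ)) =
      Nat.card (Quotient G.dartComponent) + Nat.card G.IsolatedNode := by
  have hcyc : ∀ {d d'}, G.vert d = G.vert d' → G.dartComponent d d' := fun h =>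
    Equiv.Perm.SameCycle.le_setoid G.dartComponent_rot ((G.sameCycle_iff _ _).2 h)
  refine G.card_quotient_nodes _ _ (fun d d' => ⟨fun h => ?_, fun h => ?_⟩) fun x y h hx => ?_
  · refine G.dartComponent_le (t := (G.component Finset.univ).comap G.vert) (fun d => ?_)
      (fun d => ?_) h
    · rw [Setoid.comap_rel, vert_rot]
    · rw [Setoid.comap_rel]
      obtain ⟨e, b⟩ := d
      cases b
      · exact G.component_edge (Finset.mem_univ e)
      · exact Setoid.symm' _ (G.component_edge (Finset.mem_univ e))
  · rcases G.component_le_dartConnected _ h with h | ⟨k, k', hk, hk', h⟩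
    · exact hcyc h
    · exact Setoid.trans' _ (hcyc hk.symm) (Setoid.trans' _ h (hcyc hk'))
  · rcases G.component_le_dartConnected _ h with h | ⟨k, k', hk, hk', h⟩
    · exact h
    · exact absurd hk (hx k)

/-! ### Euler's formula for spanning subgraphs -/

section Euler

variable [Finite V] [DecidableEq E]

/-- Without `B`-smoothings the loops run around the nodes: `loopPerm` is `rot⁻¹`, and the isolated
nodes contribute their circles. -/
theorem card_loop_empty [Finite E] : Nat.card (G.linkDiagram.Loop ∅) = Nat.card V := by
  rw [LinkDiagram.card_loop, card_quotient_loopSetoid, G.card_nodes, loopPerm, flipOn_empty, mul_one]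
  congr 1
  exact Nat.card_congr (Quotient.congrOfSurjective id
    (fun d d' => Equiv.Perm.sameCycle_inv) fun d => ⟨d, Setoid.refl' _ _⟩)

/-- With all sites of type `B` the loops run around the faces: `loopPerm` is conjugate, by reversal
of darts, to the inverse of the face permutation. -/
theorem card_loop_univ [Fintype E] : Nat.card (G.linkDiagram.Loop Finset.univ) =
    Nat.card (Quotient (Equiv.Perm.SameCycle.setoid (G.rot * dartFlip E))) +
      Nat.card G.IsolatedNode := by
  rw [LinkDiagram.card_loop, card_quotient_loopSetoid, loopPerm, flipOn_univ]
  congr 1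
  have hinv : (dartFlip E)⁻¹ = dartFlip E := rfl
  have hconj : G.rot⁻¹ * dartFlip E = dartFlip E * (G.rot * dartFlip E)⁻¹ * (dartFlip E)⁻¹ := by
    rw [mul_inv_rev, hinv]
    ext d <;> simp [dartFlip_dartFlip]
  refine Nat.card_congr (Quotient.congrOfSurjective (dartFlip E) (fun d d' => ?_)
    fun d => ⟨dartFlip E d, ?_⟩)
  · change Equiv.Perm.SameCycle _ _ _ ↔ Equiv.Perm.SameCycle _ _ _
    rw [hconj, Equiv.Perm.sameCycle_conj, Equiv.Perm.sameCycle_inv, hinv]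
  · rw [dartFlip_dartFlip]

/-- Twice the genus of the spanning subgraph with edge set `S`. -/
noncomputable def twiceGenus (S : Finset E) : ℤ :=
  2 * (Nat.card (Quotient (G.component S)) : ℤ) + S.card - Nat.card V
    - Nat.card (G.linkDiagram.Loop S)

/-- If the ends of the new edge are already connected, k is unchanged and ℓ changes by ±1, so the
value grows by 0 or 2. If not, k drops by 1 and two loops must merge, so the value stays the same.
-/
theorem twiceGenus_mono [Finite E] : Monotone G.twiceGenus := by
  rw [Finset.monotone_iff_forall_le_insert]
  intro S τ hτ
  have hD := G.mergesOrSplits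
  rw [twiceGenus, twiceGenus, Finset.card_insert_of_notMem hτ, component_insert]
  by_cases hk : G.component S (G.vert (τ, false)) (G.vert (τ, true))
  · rw [Setoid.joinPair_eq_self hk]
    by_cases hl : G.linkDiagram.loopSetoid S (τ, 0) (τ, 2)
    · have := hD.card_loop_of_split hτ hl
      push_cast [this]
      omega
    · have := hD.card_loop_of_merge hτ hl
      push_cast [← this]
      omega
  · have hl : ¬ G.linkDiagram.loopSetoid S (τ, 0) (τ, 2) := fun h =>
      hk (G.component_of_loopSetoid h)
    have := hD.card_loop_of_merge hτ hl
    have := Setoid.card_quotient_joinPair hk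
    omega

/-- Euler's formula for the spanning subgraphs of a plane graph, in terms of loops. -/
theorem card_loop_add_card [Fintype E] (S : Finset E) :
    Nat.card (G.linkDiagram.Loop S) + Nat.card V =
      2 * Nat.card (Quotient (G.component S)) + S.card := by
  have h₀ : G.twiceGenus ∅ = 0 := by
    have : Nat.card (Quotient (G.component ∅)) = Nat.card V := by
      rw [component_empty]
      exact (Nat.card_congr (Equiv.ofBijective (Quotient.mk ⊥)
        ⟨fun x y h => Quotient.exact h, Quotient.mk_surjective⟩)).symm
    rw [twiceGenus, this, card_loop_empty, Finset.card_empty]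
    push_cast
    ring
  have h₁ : G.twiceGenus Finset.univ = 0 := by
    have he := G.euler
    rw [← dartComponent, Nat.card_eq_fintype_card (α := E)] at he
    rw [twiceGenus, card_component_univ, card_loop_univ, G.card_nodes, Finset.card_univ]
    omega
  -- Monotonicity squeezes the value at `S` between the two zeros.
  have h₂ := G.twiceGenus_mono (Finset.empty_subset S)
  have h₃ := G.twiceGenus_mono (Finset.subset_univ S)
  rw [h₀, twiceGenus] at h₂
  rw [h₁, twiceGenus] at h₃
  omega

end Euler

end PlaneGraph

/-! ### Partial differentials in terms of labels -/

namespace LoopLabel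

theorem mul_eq_some_iff {a b c : LoopLabel} :
    mul a b = some c ↔ (a = one ∧ c = b) ∨ (b = one ∧ c = a) := by
  cases a <;> cases b <;> cases c <;> simp [mul]

/-- This is Δ(a) = X ⊗ a + a ⊗ X; for a = X the two alternatives coincide, and the set contains the
term once. -/
theorem mem_comul_iff {a b c : LoopLabel} :
    (b, c) ∈ comul a ↔ (b = X ∧ c = a) ∨ (c = X ∧ b = a) := by
  cases a <;> cases b <;> cases c <;> simp [comul]

theorem ne_one_iff {a : LoopLabel} : a ≠ one ↔ a = X := by
  cases a <;> simp

end LoopLabel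

namespace LinkDiagram

variable {X C : Type*} [DecidableEq X] {D : LinkDiagram X C}

/-- The loop through a half-arc or a crossingless circle. -/
def loopOf (D : LinkDiagram X C) (S : Finset X) : X × Fin 4 ⊕ C → D.Loop S :=
  Sum.elim (D.loopAt S) (D.loopCircle S)

theorem loopOf_surjective (S : Finset X) : Function.Surjective (D.loopOf S) := by
  rintro (c | c)
  · induction c using Quotient.inductionOn with | _ h
    exact ⟨Sum.inl h, rfl⟩
  · exact ⟨Sum.inr c, rfl⟩

theorem loopAt_eq_iff {S : Finset X} {h h' : X × Fin 4} :
    D.loopAt S h = D.loopAt S h' ↔ D.loopSetoid S h h' :=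
  ⟨fun k => Quotient.exact (Sum.inl_injective k), fun k => congrArg Sum.inl (Quotient.sound k)⟩

theorem loopAt_ne_loopCircle {S : Finset X} (h : X × Fin 4) (c : C) :
    D.loopAt S h ≠ D.loopCircle S c :=
  Sum.inl_ne_inr

theorem loopCircle_inj {S : Finset X} {c c' : C} :
    D.loopCircle S c = D.loopCircle S c' ↔ c = c' :=
  Sum.inr_injective.eq_iff

theorem loopOf_eq_iff_of_joinPair {S T : Finset X} {a b : X × Fin 4}
    (hST : D.loopSetoid T = (D.loopSetoid S).joinPair a b) (p q : X × Fin 4 ⊕ C) :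
    D.loopOf T p = D.loopOf T q ↔ D.loopOf S p = D.loopOf S q ∨
      (D.loopOf S p = D.loopOf S (Sum.inl a) ∧ D.loopOf S (Sum.inl b) = D.loopOf S q) ∨
      (D.loopOf S p = D.loopOf S (Sum.inl b) ∧ D.loopOf S (Sum.inl a) = D.loopOf S q) := by
  rcases p with p | p <;> rcases q with q | q
  · simp only [loopOf, Sum.elim_inl, loopAt_eq_iff]
    rw [hST]
    rfl
  · simp [loopOf, loopAt_ne_loopCircle]
  · simp [loopOf, (loopAt_ne_loopCircle _ _).symm]
  · simp [loopOf, (loopAt_ne_loopCircle _ _).symm, loopCircle_inj]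

theorem MergesOrSplits.loopOf_of_merge (hD : D.MergesOrSplits) {S : Finset X} {τ : X}
    (hτ : τ ∉ S) (h : D.loopOf S (Sum.inl (τ, 0)) ≠ D.loopOf S (Sum.inl (τ, 2)))
    (p q : X × Fin 4 ⊕ C) :
    D.loopOf (insert τ S) p = D.loopOf (insert τ S) q ↔ D.loopOf S p = D.loopOf S q ∨
      (D.loopOf S p = D.loopOf S (Sum.inl (τ, 0)) ∧ D.loopOf S (Sum.inl (τ, 2)) = D.loopOf S q) ∨
      (D.loopOf S p = D.loopOf S (Sum.inl (τ, 2)) ∧ D.loopOf S (Sum.inl (τ, 0)) = D.loopOf S q) :=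
  loopOf_eq_iff_of_joinPair (hD.of_merge hτ fun k => h (loopAt_eq_iff.2 k)) p q

theorem loopOf_of_split {S : Finset X} {τ : X}
    (h : D.loopOf S (Sum.inl (τ, 0)) = D.loopOf S (Sum.inl (τ, 2))) (p q : X × Fin 4 ⊕ C) :
    D.loopOf S p = D.loopOf S q ↔ D.loopOf (insert τ S) p = D.loopOf (insert τ S) q ∨
      (D.loopOf (insert τ S) p = D.loopOf (insert τ S) (Sum.inl (τ, 0)) ∧
        D.loopOf (insert τ S) (Sum.inl (τ, 2)) = D.loopOf (insert τ S) q) ∨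
      (D.loopOf (insert τ S) p = D.loopOf (insert τ S) (Sum.inl (τ, 2)) ∧
        D.loopOf (insert τ S) (Sum.inl (τ, 0)) = D.loopOf (insert τ S) q) :=
  loopOf_eq_iff_of_joinPair (of_split (loopAt_eq_iff.1 h)) p q

theorem MergesOrSplits.loopOf_eq_iff (hD : D.MergesOrSplits) {S : Finset X} {τ : X}
    (hτ : τ ∉ S) : D.loopOf (insert τ S) (Sum.inl (τ, 0)) = D.loopOf (insert τ S) (Sum.inl (τ, 2)) ↔
      D.loopOf S (Sum.inl (τ, 0)) ≠ D.loopOf S (Sum.inl (τ, 2)) :=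
  loopAt_eq_iff.trans ((hD S τ hτ).trans (not_congr loopAt_eq_iff).symm)

/-! ### Relabelling the loops of an enhanced state -/

namespace EnhancedState

/-- The label of the loop through a half-arc or a crossingless circle. -/
def label (s : D.EnhancedState) (p : X × Fin 4 ⊕ C) : LoopLabel := s.2 (D.loopOf s.1 p)

theorem ext_label {s t : D.EnhancedState} (h : s.1 = t.1) (hl : ∀ p, s.label p = t.label p) :
    s = t := by
  obtain ⟨S, a⟩ := s
  obtain ⟨T, b⟩ := t
  obtain rfl : S = T := h
  refine congrArg (Sigma.mk S) (funext fun l => ?_)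
  obtain ⟨p, rfl⟩ := loopOf_surjective S l
  exact hl p

theorem label_congr (s : D.EnhancedState) {p q : X × Fin 4 ⊕ C}
    (h : D.loopOf s.1 p = D.loopOf s.1 q) : s.label p = s.label q :=
  congrArg s.2 h

open Classical in
/-- Change the label of one loop. -/
noncomputable def setLabel (s : D.EnhancedState) (p : X × Fin 4 ⊕ C) (x : LoopLabel) :
    D.EnhancedState :=
  ⟨s.1, Function.update s.2 (D.loopOf s.1 p) x⟩

@[simp] theorem setLabel_fst (s : D.EnhancedState) (p : X × Fin 4 ⊕ C) (x : LoopLabel) :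
    (s.setLabel p x).1 = s.1 := rfl

theorem label_setLabel_of_eq {s : D.EnhancedState} {p q : X × Fin 4 ⊕ C}
    (h : D.loopOf s.1 q = D.loopOf s.1 p) (x : LoopLabel) : (s.setLabel p x).label q = x := by
  simp only [label, setLabel, h, Function.update_self]

theorem label_setLabel_of_ne {s : D.EnhancedState} {p q : X × Fin 4 ⊕ C}
    (h : D.loopOf s.1 q ≠ D.loopOf s.1 p) (x : LoopLabel) :
    (s.setLabel p x).label q = s.label q := by
  classical exact Function.update_of_ne h x s.2

@[simp] theorem label_setLabel_self (s : D.EnhancedState) (p : X × Fin 4 ⊕ C) (x : LoopLabel) :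
    (s.setLabel p x).label p = x :=
  label_setLabel_of_eq rfl x

theorem setLabel_eq_self {s : D.EnhancedState} {p : X × Fin 4 ⊕ C} {x : LoopLabel}
    (h : s.label p = x) : s.setLabel p x = s := by
  refine ext_label rfl fun q => ?_
  by_cases hq : D.loopOf s.1 q = D.loopOf s.1 p
  · rw [label_setLabel_of_eq hq, ← h, s.label_congr hq]
  · rw [label_setLabel_of_ne hq]

@[simp] theorem setLabel_setLabel (s : D.EnhancedState) (p : X × Fin 4 ⊕ C) (x y : LoopLabel) :
    (s.setLabel p x).setLabel p y = s.setLabel p y := by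
  refine ext_label rfl fun q => ?_
  by_cases h : D.loopOf s.1 q = D.loopOf s.1 p
  · rw [label_setLabel_of_eq (s := s.setLabel p x) h, label_setLabel_of_eq h]
  · rw [label_setLabel_of_ne (s := s.setLabel p x) h, label_setLabel_of_ne h,
      label_setLabel_of_ne h]

/-- Both changes write the same label, so the two loops may coincide. -/
theorem setLabel_comm (s : D.EnhancedState) (p q : X × Fin 4 ⊕ C) (x : LoopLabel) :
    (s.setLabel p x).setLabel q x = (s.setLabel q x).setLabel p x := by
  have key : ∀ p q r, D.loopOf s.1 r = D.loopOf s.1 p →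
      ((s.setLabel p x).setLabel q x).label r = x := by
    intro p q r hp
    by_cases hq : D.loopOf s.1 r = D.loopOf s.1 q
    · rw [label_setLabel_of_eq (s := s.setLabel p x) hq]
    · rw [label_setLabel_of_ne (s := s.setLabel p x) hq, label_setLabel_of_eq hp]
  refine ext_label rfl fun r => ?_
  by_cases hp : D.loopOf s.1 r = D.loopOf s.1 p
  · rw [key p q r hp, label_setLabel_of_eq (s := s.setLabel q x) hp]
  · by_cases hq : D.loopOf s.1 r = D.loopOf s.1 q
    · rw [key q p r hq, label_setLabel_of_eq (s := s.setLabel p x) hq]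
    · rw [label_setLabel_of_ne (s := s.setLabel p x) hq, label_setLabel_of_ne hp,
        label_setLabel_of_ne (s := s.setLabel q x) hp, label_setLabel_of_ne hq]

theorem setLabel_congr (s : D.EnhancedState) {p q : X × Fin 4 ⊕ C} (x : LoopLabel)
    (h : D.loopOf s.1 p = D.loopOf s.1 q) : s.setLabel p x = s.setLabel q x := by
  rw [setLabel, setLabel, h]

variable (D) in
/-- The state `S` with all labels `1`. -/
def allOne (S : Finset X) : D.EnhancedState := ⟨S, fun _ => LoopLabel.one⟩

@[simp] theorem allOne_fst (S : Finset X) : (allOne D S).1 = S := rfl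

@[simp] theorem label_allOne (S : Finset X) (p : X × Fin 4 ⊕ C) :
    (allOne D S).label p = LoopLabel.one := rfl

open Classical in
variable (D) in
/-- The state `S` with label `X` on the loops in `T` and label `1` on the other loops. -/
noncomputable def labelX (S : Finset X) (T : Finset (D.Loop S)) : D.EnhancedState :=
  ⟨S, fun l => if l ∈ T then LoopLabel.X else LoopLabel.one⟩

theorem label_labelX_of_mem {S : Finset X} {T : Finset (D.Loop S)} {p : X × Fin 4 ⊕ C}
    (h : D.loopOf S p ∈ T) : (labelX D S T).label p = LoopLabel.X :=
  if_pos h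

theorem label_labelX_of_notMem {S : Finset X} {T : Finset (D.Loop S)} {p : X × Fin 4 ⊕ C}
    (h : D.loopOf S p ∉ T) : (labelX D S T).label p = LoopLabel.one :=
  if_neg h

/-- Every enhanced state arises from one with all labels `1` by turning labels `1` into `X`. -/
theorem induction_label [Finite X] [Finite C] {P : D.EnhancedState → Prop}
    (h₁ : ∀ S, P (allOne D S))
    (h₂ : ∀ s p, s.label p = LoopLabel.one → P s → P (s.setLabel p LoopLabel.X)) (s) : P s := by
  classical
  have := Fintype.ofFinite (D.Loop s.1)
  have key : ∀ T : Finset (D.Loop s.1), P (labelX D s.1 T) := by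
    intro T
    induction T using Finset.induction_on with
    | empty =>
      rw [show labelX D s.1 ∅ = allOne D s.1 from
        ext_label rfl fun q => label_labelX_of_notMem (Finset.notMem_empty _)]
      exact h₁ s.1
    | insert l T hl ih =>
      obtain ⟨p, rfl⟩ := loopOf_surjective s.1 l
      rw [show labelX D s.1 (insert (D.loopOf s.1 p) T) =
        (labelX D s.1 T).setLabel p LoopLabel.X from ext_label rfl fun q => ?_]
      · exact h₂ _ p (label_labelX_of_notMem hl) ih
      · by_cases h : D.loopOf s.1 q = D.loopOf s.1 p
        · rw [label_setLabel_of_eq (s := labelX D s.1 T) h,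
            label_labelX_of_mem (Finset.mem_insert.2 (Or.inl h))]
        · rw [label_setLabel_of_ne (s := labelX D s.1 T) h]
          by_cases hq : D.loopOf s.1 q ∈ T
          · rw [label_labelX_of_mem hq, label_labelX_of_mem (Finset.mem_insert_of_mem hq)]
          · rw [label_labelX_of_notMem hq, label_labelX_of_notMem (by simp [h, hq])]
  rw [show s = labelX D s.1 (Finset.univ.filter fun l => s.2 l = LoopLabel.X) from
    ext_label rfl fun q => ?_]
  · exact key _
  · by_cases h : s.label q = LoopLabel.X
    · rw [label_labelX_of_mem (Finset.mem_filter.2 ⟨Finset.mem_univ _, h⟩), h]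
    · rw [label_labelX_of_notMem fun k => h (Finset.mem_filter.1 k).2]
      by_contra h'
      exact h (LoopLabel.ne_one_iff.1 h')

end EnhancedState

open EnhancedState

/-- Every loop through `τ` passes through (τ,0) or (τ,2), so two inequalities replace the four, and
half-arcs and circles can be treated together. -/
theorem isPartialTerm_iff {τ : X} {s s' : D.EnhancedState} :
    D.IsPartialTerm τ s s' ↔ τ ∉ s.1 ∧ s'.1 = insert τ s.1 ∧
      (∀ p, D.loopOf s.1 p ≠ D.loopOf s.1 (Sum.inl (τ, 0)) →
        D.loopOf s.1 p ≠ D.loopOf s.1 (Sum.inl (τ, 2)) → s'.label p = s.label p) ∧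
      ((D.loopOf s.1 (Sum.inl (τ, 0)) ≠ D.loopOf s.1 (Sum.inl (τ, 2)) ∧
        D.loopOf s'.1 (Sum.inl (τ, 0)) = D.loopOf s'.1 (Sum.inl (τ, 2)) ∧
        LoopLabel.mul (s.label (Sum.inl (τ, 0))) (s.label (Sum.inl (τ, 2))) =
          some (s'.label (Sum.inl (τ, 0)))) ∨
      (D.loopOf s.1 (Sum.inl (τ, 0)) = D.loopOf s.1 (Sum.inl (τ, 2)) ∧
        D.loopOf s'.1 (Sum.inl (τ, 0)) ≠ D.loopOf s'.1 (Sum.inl (τ, 2)) ∧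
        (s'.label (Sum.inl (τ, 0)), s'.label (Sum.inl (τ, 2))) ∈
          LoopLabel.comul (s.label (Sum.inl (τ, 0))))) := by
  unfold IsPartialTerm
  refine and_congr_right fun hτ => and_congr_right fun hs => ?_
  rw [← and_assoc]
  refine and_congr ⟨?_, ?_⟩ Iff.rfl
  · rintro ⟨h₁, h₂⟩ (p | c) hp₀ hp₂
    · refine h₁ p fun k => ?_
      rcases D.loopSetoid_crossing s.1 τ k with h | h
      · rw [loopAt_eq_iff.2 h]; exact hp₀
      · rw [loopAt_eq_iff.2 h]; exact hp₂
    · exact h₂ c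
  · exact fun h => ⟨fun p hp => h (Sum.inl p) (hp 0) (hp 2),
      fun c => h (Sum.inr c) (loopAt_ne_loopCircle _ _).symm
        (loopAt_ne_loopCircle _ _).symm⟩

/-- Terms of X·a and of Δ(X) carry only the label X, so an X never turns back into 1. -/
theorem MergesOrSplits.label_eq_X (hD : D.MergesOrSplits) {τ : X} {s s' : D.EnhancedState}
    (h : D.IsPartialTerm τ s s') {p : X × Fin 4 ⊕ C} (hp : s.label p = LoopLabel.X) :
    s'.label p = LoopLabel.X := by
  obtain ⟨hτ, hS, hout, h⟩ := isPartialTerm_iff.1 h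
  have hs := fun p q => s.label_congr (p := p) (q := q)
  have hs' := fun p q => s'.label_congr (p := p) (q := q)
  rw [hS, LoopLabel.mul_eq_some_iff, LoopLabel.mem_comul_iff] at h
  rw [hS] at hs'
  rcases h with ⟨h₁, h₂, h₃⟩ | ⟨h₁, h₂, h₃⟩
  · have hr := hD.loopOf_of_merge hτ h₁
    grind
  · have hr := loopOf_of_split h₁
    grind

/-- If the label at `p` survives and `p` lies on a loop through `τ`, then the other factor is 1
(merge) or the other new label can be taken to be X (split); in both cases the label at `p` is
passed on whatever it is. This is the X-linearity of the partial differential, term by term. -/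
theorem MergesOrSplits.isPartialTerm_setLabel (hD : D.MergesOrSplits) {τ : X}
    {s s' : D.EnhancedState} (h : D.IsPartialTerm τ s s') {p : X × Fin 4 ⊕ C}
    (hp : s.label p = s'.label p) (y : LoopLabel) :
    D.IsPartialTerm τ (s.setLabel p y) (s'.setLabel p y) := by
  obtain ⟨hτ, hS, hout, h⟩ := isPartialTerm_iff.1 h
  have hs := fun p q => s.label_congr (p := p) (q := q)
  have hs' := fun p q => s'.label_congr (p := p) (q := q)
  have hl := fun q h => label_setLabel_of_eq (s := s) (p := p) (q := q) h y
  have hl' := fun q h => label_setLabel_of_eq (s := s') (p := p) (q := q) h y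
  have hn := fun q h => label_setLabel_of_ne (s := s) (p := p) (q := q) h y
  have hn' := fun q h => label_setLabel_of_ne (s := s') (p := p) (q := q) h y
  rw [isPartialTerm_iff]
  simp only [setLabel_fst]
  rw [hS, LoopLabel.mul_eq_some_iff, LoopLabel.mem_comul_iff] at h
  rw [hS] at hs' hl' hn' ⊢
  refine ⟨hτ, rfl, ?_, ?_⟩
  · intro q hq₀ hq₂
    rcases h with ⟨h₁, h₂, h₃⟩ | ⟨h₁, h₂, h₃⟩
    · have hr := hD.loopOf_of_merge hτ h₁
      grind
    · have hr := loopOf_of_split h₁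
      grind
  · rcases h with ⟨h₁, h₂, h₃⟩ | ⟨h₁, h₂, h₃⟩
    · have hr := hD.loopOf_of_merge hτ h₁
      refine Or.inl ⟨h₁, h₂, ?_⟩
      rw [LoopLabel.mul_eq_some_iff]
      grind
    · have hr := loopOf_of_split h₁
      refine Or.inr ⟨h₁, h₂, ?_⟩
      rw [LoopLabel.mem_comul_iff]
      grind

end LinkDiagram

/-! ### Partial differentials of units and the degree j -/

namespace LinkDiagram

open EnhancedState

section Degree

variable {X C : Type*} [DecidableEq X] {D : LinkDiagram X C}

theorem MergesOrSplits.isPartialTerm_allOne (hD : D.MergesOrSplits) {τ : X} {S : Finset X}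
    {s' : D.EnhancedState} (hτ : τ ∉ S) :
    D.IsPartialTerm τ (allOne D S) s' ↔
      (D.loopOf S (Sum.inl (τ, 0)) ≠ D.loopOf S (Sum.inl (τ, 2)) ∧
        s' = allOne D (insert τ S)) ∨
      (D.loopOf S (Sum.inl (τ, 0)) = D.loopOf S (Sum.inl (τ, 2)) ∧
        (s' = (allOne D (insert τ S)).setLabel (Sum.inl (τ, 0)) LoopLabel.X ∨
          s' = (allOne D (insert τ S)).setLabel (Sum.inl (τ, 2)) LoopLabel.X)) := by
  have hD' := hD.loopOf_eq_iff hτ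
  rw [isPartialTerm_iff, LoopLabel.mul_eq_some_iff, LoopLabel.mem_comul_iff]
  simp only [allOne_fst, label_allOne]
  constructor
  · rintro ⟨-, hS, hout, h⟩
    have hs' := fun p q => s'.label_congr (p := p) (q := q)
    rw [hS] at h hs'
    rcases h with ⟨h₁, h₂, h₃⟩ | ⟨h₁, h₂, h₃⟩
    · refine Or.inl ⟨h₁, ext_label hS fun q => ?_⟩
      have hr := hD.loopOf_of_merge hτ h₁
      rw [label_allOne]
      grind
    · refine Or.inr ⟨h₁, ?_⟩
      have hr := loopOf_of_split h₁
      rcases h₃ with h₃ | h₃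
      · refine Or.inl (ext_label hS fun q => ?_)
        have hl := fun h => label_setLabel_of_eq (s := allOne D (insert τ S))
          (p := Sum.inl (τ, 0)) (q := q) h LoopLabel.X
        have hn := fun h => label_setLabel_of_ne (s := allOne D (insert τ S))
          (p := Sum.inl (τ, 0)) (q := q) h LoopLabel.X
        rw [label_allOne] at hn
        rw [allOne_fst] at hl hn
        grind
      · refine Or.inr (ext_label hS fun q => ?_)
        have hl := fun h => label_setLabel_of_eq (s := allOne D (insert τ S))
          (p := Sum.inl (τ, 2)) (q := q) h LoopLabel.X
        have hn := fun h => label_setLabel_of_ne (s := allOne D (insert τ S))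
          (p := Sum.inl (τ, 2)) (q := q) h LoopLabel.X
        rw [label_allOne] at hn
        rw [allOne_fst] at hl hn
        grind
  · rintro (⟨h₁, rfl⟩ | ⟨h₁, rfl | rfl⟩)
    · refine ⟨hτ, rfl, fun _ _ _ => rfl, Or.inl ⟨h₁, hD'.2 h₁, by simp⟩⟩
    · have h₂ : D.loopOf (insert τ S) (Sum.inl (τ, 0)) ≠ D.loopOf (insert τ S) (Sum.inl (τ, 2)) :=
        fun h => hD'.1 h h₁
      have hr := loopOf_of_split h₁
      refine ⟨hτ, rfl, fun q hq _ => ?_, Or.inr ⟨h₁, h₂, Or.inl ⟨?_, ?_⟩⟩⟩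
      · rw [label_setLabel_of_ne, label_allOne]
        exact fun h => hq ((hr _ _).2 (Or.inl h))
      · rw [label_setLabel_self]
      · exact label_setLabel_of_ne (s := allOne D (insert τ S)) h₂.symm _
    · have h₂ : D.loopOf (insert τ S) (Sum.inl (τ, 0)) ≠ D.loopOf (insert τ S) (Sum.inl (τ, 2)) :=
        fun h => hD'.1 h h₁
      have hr := loopOf_of_split h₁
      refine ⟨hτ, rfl, fun q _ hq => ?_, Or.inr ⟨h₁, h₂, Or.inr ⟨?_, ?_⟩⟩⟩
      · rw [label_setLabel_of_ne, label_allOne]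
        exact fun h => hq ((hr _ _).2 (Or.inl h))
      · rw [label_setLabel_self]
      · exact label_setLabel_of_ne (s := allOne D (insert τ S)) h₂ _

theorem IsPartialTerm.nB_eq {τ : X} {s s' : D.EnhancedState} (h : D.IsPartialTerm τ s s') :
    s'.nB = s.nB + 1 := by
  rw [nB, nB, h.2.1, Finset.card_insert_of_notMem h.1]

theorem EnhancedState.lam_eq_sum (s : D.EnhancedState) (_ : Fintype (D.Loop s.1)) :
    s.lam = ∑ l, if s.2 l = LoopLabel.one then (1 : ℤ) else -1 := by
  classical
  have h : ∀ l, (if s.2 l = LoopLabel.one then (1 : ℤ) else -1) =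
      (if s.2 l = LoopLabel.one then 1 else 0) - (if s.2 l = LoopLabel.X then 1 else 0) := by
    intro l
    cases s.2 l <;> simp
  simp only [h, Finset.sum_sub_distrib, Finset.sum_boole, lam, Nat.card_eq_fintype_card,
    Fintype.card_subtype]

variable [Finite X] [Finite C]

namespace EnhancedState

theorem lam_allOne (S : Finset X) : (allOne D S).lam = Nat.card (D.Loop S) := by
  have inst : Fintype (D.Loop S) := Fintype.ofFinite _
  rw [lam_eq_sum _ inst, Nat.card_eq_fintype_card]
  simp [allOne]

theorem lam_setLabel_X {s : D.EnhancedState} {p : X × Fin 4 ⊕ C}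
    (h : s.label p = LoopLabel.one) : (s.setLabel p LoopLabel.X).lam = s.lam - 2 := by
  classical
  have inst : Fintype (D.Loop s.1) := Fintype.ofFinite _
  rw [lam_eq_sum s inst, lam_eq_sum (s.setLabel p LoopLabel.X) inst]
  change ∑ l : D.Loop s.1, (if Function.update s.2 (D.loopOf s.1 p) LoopLabel.X l = LoopLabel.one
    then (1 : ℤ) else -1) = _
  rw [← Finset.add_sum_erase _ _ (Finset.mem_univ (D.loopOf s.1 p)),
    ← Finset.add_sum_erase (a := D.loopOf s.1 p) _ (fun l => if s.2 l = LoopLabel.one then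
    (1 : ℤ) else -1) (Finset.mem_univ _)]
  have h' : s.2 (D.loopOf s.1 p) = LoopLabel.one := h
  rw [Function.update_self, if_pos h', if_neg (by simp), Finset.sum_congr rfl fun l hl => by
    rw [Function.update_of_ne (Finset.ne_of_mem_erase hl)]]
  ring

theorem jdeg_setLabel_X {s : D.EnhancedState} {p : X × Fin 4 ⊕ C}
    (h : s.label p = LoopLabel.one) : (s.setLabel p LoopLabel.X).jdeg = s.jdeg - 2 := by
  rw [jdeg, jdeg, lam_setLabel_X h, nB, nB, setLabel_fst]
  ring

theorem jdeg_allOne (S : Finset X) :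
    (allOne D S).jdeg = S.card + Nat.card (D.Loop S) := by
  rw [jdeg, lam_allOne, nB, allOne_fst]

end EnhancedState

/-- For a unit, one more `B`-site is balanced by one loop less (merge), or by one loop more together
with one label X (split). Each further X in the source is also an X in the target and lowers both
degrees by 2. -/
theorem MergesOrSplits.jdeg_eq (hD : D.MergesOrSplits) {τ : X} {s s' : D.EnhancedState}
    (h : D.IsPartialTerm τ s s') : s'.jdeg = s.jdeg := by
  induction s using induction_label generalizing s' with
  | h₁ S =>
    have hτ : τ ∉ S := h.1
    rcases (hD.isPartialTerm_allOne hτ).1 h with ⟨h₁, rfl⟩ | ⟨h₁, rfl | rfl⟩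
    · have := hD.card_loop_of_merge hτ fun k => h₁ (loopAt_eq_iff.2 k)
      rw [jdeg_allOne, jdeg_allOne, Finset.card_insert_of_notMem hτ, ← this]
      push_cast
      ring
    all_goals
      have := hD.card_loop_of_split hτ (loopAt_eq_iff.1 h₁)
      rw [jdeg_setLabel_X rfl, jdeg_allOne, jdeg_allOne, Finset.card_insert_of_notMem hτ, this]
      push_cast
      ring
  | h₂ s p hp ih =>
    have hX := hD.label_eq_X h (label_setLabel_self s p _)
    have h' := hD.isPartialTerm_setLabel h ((label_setLabel_self s p _).trans hX.symm)
      LoopLabel.one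
    rw [setLabel_setLabel, setLabel_eq_self hp] at h'
    have := jdeg_setLabel_X (label_setLabel_self s' p LoopLabel.one)
    rw [setLabel_setLabel, setLabel_eq_self hX, ih h'] at this
    rw [this, jdeg_setLabel_X hp]

end Degree

/-! ### The partial differentials commute -/

section Operators

variable {X C : Type*} [LinearOrder X]
variable (R : Type*) [CommRing R] {D : LinkDiagram X C}

open Classical in
/-- Multiplication by `X` on the tensor factor of the loop through a half-arc or a circle. -/
noncomputable def mulX (p : X × Fin 4 ⊕ C) : D.Chain R →ₗ[R] D.Chain R where
  toFun f s := if s.label p = LoopLabel.X then f (s.setLabel p LoopLabel.one) else 0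
  map_add' f g := by
    funext s
    by_cases h : s.label p = LoopLabel.X <;> simp [h]
  map_smul' a f := by
    funext s
    by_cases h : s.label p = LoopLabel.X <;> simp [h]

variable {R}

theorem mulX_apply_of_eq {p : X × Fin 4 ⊕ C} (f : D.Chain R) {s : D.EnhancedState}
    (h : s.label p = LoopLabel.X) : mulX R p f s = f (s.setLabel p LoopLabel.one) :=
  if_pos h

theorem mulX_apply_of_ne {p : X × Fin 4 ⊕ C} (f : D.Chain R) {s : D.EnhancedState}
    (h : s.label p ≠ LoopLabel.X) : mulX R p f s = 0 :=
  if_neg h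

/-- Because X² = 0, both sides vanish at `s` unless `p` and `q` lie on distinct loops labelled X;
there both orders evaluate `f` at the same state. -/
theorem mulX_comm (p q : X × Fin 4 ⊕ C) (f : D.Chain R) :
    mulX R p (mulX R q f) = mulX R q (mulX R p f) := by
  have key : ∀ (p q : X × Fin 4 ⊕ C) (s : D.EnhancedState), mulX R p (mulX R q f) s ≠ 0 →
      s.label p = LoopLabel.X ∧ s.label q = LoopLabel.X ∧ D.loopOf s.1 q ≠ D.loopOf s.1 p := by
    intro p q s h
    have hp : s.label p = LoopLabel.X := by
      by_contra k
      exact h (mulX_apply_of_ne _ k)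
    rw [mulX_apply_of_eq _ hp] at h
    have hq : (s.setLabel p LoopLabel.one).label q = LoopLabel.X := by
      by_contra k
      exact h (mulX_apply_of_ne _ k)
    have hpq : D.loopOf s.1 q ≠ D.loopOf s.1 p := by
      intro k
      rw [label_setLabel_of_eq k] at hq
      cases hq
    exact ⟨hp, by rwa [label_setLabel_of_ne hpq] at hq, hpq⟩
  have key' : ∀ (p q : X × Fin 4 ⊕ C) (s : D.EnhancedState), s.label p = LoopLabel.X →
      s.label q = LoopLabel.X → D.loopOf s.1 q ≠ D.loopOf s.1 p →
      mulX R p (mulX R q f) s = f ((s.setLabel p LoopLabel.one).setLabel q LoopLabel.one) := by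
    intro p q s hp hq hpq
    rw [mulX_apply_of_eq _ hp, mulX_apply_of_eq _ (by rwa [label_setLabel_of_ne hpq])]
  funext s
  by_cases h : s.label p = LoopLabel.X ∧ s.label q = LoopLabel.X ∧ D.loopOf s.1 q ≠ D.loopOf s.1 p
  · rw [key' p q s h.1 h.2.1 h.2.2, key' q p s h.2.1 h.1 h.2.2.symm, setLabel_comm]
  · have h₁ : mulX R p (mulX R q f) s = 0 := by
      by_contra k
      exact h (key p q s k)
    have h₂ : mulX R q (mulX R p f) s = 0 := by
      by_contra k
      obtain ⟨h₁, h₂, h₃⟩ := key q p s k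
      exact h ⟨h₂, h₁, h₃.symm⟩
    rw [h₁, h₂]

open Classical in
variable (R D) in
/-- The basis element of the state `S` with all labels `1`. -/
noncomputable def unitChain (S : Finset X) : D.Chain R := Pi.single (allOne D S) 1

open Classical in
theorem mulX_single {p : X × Fin 4 ⊕ C} {s : D.EnhancedState} (h : s.label p = LoopLabel.one) :
    mulX R p (Pi.single s 1) = Pi.single (s.setLabel p LoopLabel.X) 1 := by
  funext t
  by_cases ht : t = s.setLabel p LoopLabel.X
  · subst ht
    rw [mulX_apply_of_eq _ (label_setLabel_self _ _ _), setLabel_setLabel, setLabel_eq_self h,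
      Pi.single_eq_same, Pi.single_eq_same]
  · rw [Pi.single_eq_of_ne ht]
    by_cases hX : t.label p = LoopLabel.X
    · rw [mulX_apply_of_eq _ hX, Pi.single_eq_of_ne]
      intro k
      apply ht
      rw [← k, setLabel_setLabel, setLabel_eq_self hX]
    · exact mulX_apply_of_ne _ hX

theorem mulX_unitChain_congr {S : Finset X} {p q : X × Fin 4 ⊕ C}
    (h : D.loopOf S p = D.loopOf S q) :
    mulX R p (unitChain R D S) = mulX R q (unitChain R D S) := by
  rw [unitChain, mulX_single rfl, mulX_single rfl, setLabel_congr (allOne D S) _ h]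

variable [Fintype X] [Finite C]

open Classical in
variable (R) in
/-- The partial differential at a site, without sign. -/
noncomputable def partialDiff (τ : X) : D.Chain R →ₗ[R] D.Chain R where
  toFun f s' := ∑ s : D.EnhancedState, if D.IsPartialTerm τ s s' then f s else 0
  map_add' f g := by
    funext s'
    simp only [Pi.add_apply, ← Finset.sum_add_distrib]
    exact Finset.sum_congr rfl fun s _ => by split_ifs <;> simp
  map_smul' a f := by
    funext s'
    simp [Finset.mul_sum]

open Classical in
theorem partialDiff_apply (τ : X) (f : D.Chain R) (s' : D.EnhancedState) :
    partialDiff R τ f s' = ∑ s : D.EnhancedState, if D.IsPartialTerm τ s s' then f s else 0 := rfl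

/-- Relabelling `p` from X to 1 in source and target matches the terms on the two sides bijectively;
X-labels persist, so a target with label 1 at `p` has only sources with label 1 there. -/
theorem MergesOrSplits.partialDiff_mulX (hD : D.MergesOrSplits) (τ : X) (p : X × Fin 4 ⊕ C)
    (f : D.Chain R) : partialDiff R τ (mulX R p f) = mulX R p (partialDiff R τ f) := by
  classical
  funext s'
  rw [partialDiff_apply]
  by_cases hX : s'.label p = LoopLabel.X
  · rw [mulX_apply_of_eq _ hX, partialDiff_apply, ← Finset.sum_filter, ← Finset.sum_filter]
    rw [← Finset.sum_filter_add_sum_filter_not _ fun s : D.EnhancedState =>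
      s.label p = LoopLabel.X]
    rw [Finset.sum_eq_zero (s := Finset.filter _ _) (f := mulX R p f) fun s hs =>
      mulX_apply_of_ne f (Finset.mem_filter.1 hs).2, add_zero]
    refine Finset.sum_nbij' (fun s => s.setLabel p LoopLabel.one)
      (fun s => s.setLabel p LoopLabel.X) ?_ ?_ ?_ ?_ ?_
    · intro s hs
      simp only [Finset.mem_filter, Finset.mem_univ, true_and] at hs ⊢
      exact hD.isPartialTerm_setLabel hs.1 (hs.2.trans hX.symm) _
    · intro s hs
      simp only [Finset.mem_filter, Finset.mem_univ, true_and] at hs ⊢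
      have h₁ : s.label p = LoopLabel.one := by
        by_contra k
        have := hD.label_eq_X hs (LoopLabel.ne_one_iff.1 k)
        rw [label_setLabel_self] at this
        cases this
      refine ⟨?_, label_setLabel_self _ _ _⟩
      have := hD.isPartialTerm_setLabel hs (h₁.trans (label_setLabel_self _ _ _).symm) LoopLabel.X
      rwa [setLabel_setLabel, setLabel_eq_self hX] at this
    · intro s hs
      simp only [Finset.mem_filter, Finset.mem_univ, true_and] at hs
      rw [setLabel_setLabel, setLabel_eq_self hs.2]
    · intro s hs
      simp only [Finset.mem_filter, Finset.mem_univ, true_and] at hs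
      have h₁ : s.label p = LoopLabel.one := by
        by_contra k
        have := hD.label_eq_X hs (LoopLabel.ne_one_iff.1 k)
        rw [label_setLabel_self] at this
        cases this
      rw [setLabel_setLabel, setLabel_eq_self h₁]
    · intro s hs
      exact mulX_apply_of_eq f (Finset.mem_filter.1 hs).2
  · rw [mulX_apply_of_ne _ hX]
    refine Finset.sum_eq_zero fun s _ => ?_
    split_ifs with h
    · exact mulX_apply_of_ne f fun k => hX (hD.label_eq_X h k)
    · rfl

open Classical in
theorem partialDiff_single (τ : X) (s s' : D.EnhancedState) :
    partialDiff R τ (Pi.single s 1) s' = if D.IsPartialTerm τ s s' then 1 else 0 := by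
  rw [partialDiff_apply, Finset.sum_eq_single s]
  · simp
  · intro t _ ht
    simp [Pi.single_eq_of_ne ht]
  · simp

theorem partialDiff_unitChain_of_mem {τ : X} {S : Finset X} (h : τ ∈ S) :
    partialDiff R τ (unitChain R D S) = 0 := by
  classical
  funext s'
  rw [unitChain, partialDiff_single, if_neg fun k => k.1 h]
  rfl

theorem MergesOrSplits.partialDiff_unitChain_of_merge (hD : D.MergesOrSplits) {τ : X}
    {S : Finset X} (hτ : τ ∉ S)
    (h : D.loopOf S (Sum.inl (τ, 0)) ≠ D.loopOf S (Sum.inl (τ, 2))) :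
    partialDiff R τ (unitChain R D S) = unitChain R D (insert τ S) := by
  classical
  funext s'
  rw [unitChain, partialDiff_single, unitChain, Pi.single_apply]
  simp [hD.isPartialTerm_allOne hτ, h]

theorem MergesOrSplits.partialDiff_unitChain_of_split (hD : D.MergesOrSplits) {τ : X}
    {S : Finset X} (hτ : τ ∉ S)
    (h : D.loopOf S (Sum.inl (τ, 0)) = D.loopOf S (Sum.inl (τ, 2))) :
    partialDiff R τ (unitChain R D S) =
      mulX R (Sum.inl (τ, 0)) (unitChain R D (insert τ S)) +
        mulX R (Sum.inl (τ, 2)) (unitChain R D (insert τ S)) := by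
  classical
  have h₂ : ¬ _ := fun k => (hD.loopOf_eq_iff hτ).1 k h
  have hne : (allOne D (insert τ S)).setLabel (Sum.inl (τ, 0)) LoopLabel.X ≠
      (allOne D (insert τ S)).setLabel (Sum.inl (τ, 2)) LoopLabel.X := by
    intro k
    have := congrArg (fun s => s.label (Sum.inl (τ, 0))) k
    simp only [label_setLabel_self] at this
    rw [label_setLabel_of_ne h₂, label_allOne] at this
    cases this
  funext s'
  rw [unitChain, partialDiff_single, unitChain, mulX_single rfl, mulX_single rfl, Pi.add_apply,
    Pi.single_apply, Pi.single_apply]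
  simp only [hD.isPartialTerm_allOne hτ, h, ne_eq, not_true_eq_false, false_and, true_and,
    false_or]
  by_cases h₁ : s' = (allOne D (insert τ S)).setLabel (Sum.inl (τ, 0)) LoopLabel.X
  · have h₃ := h₁ ▸ hne
    simp [h₁, hne]
  · simp [h₁]

end Operators

end LinkDiagram

/-! ### Commutation on units, signs and ∂² = 0 -/

namespace LinkDiagram

open EnhancedState

variable {X C : Type*} [LinearOrder X] {R : Type*} [CommRing R] {D : LinkDiagram X C}

variable (R) in
/-- Multiplication of each enhanced state by the sign of the site `τ`. -/
def signDiff (τ : X) : D.Chain R →ₗ[R] D.Chain R where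
  toFun f s := (-1) ^ (s.1.filter fun σ => σ < τ).card * f s
  map_add' f g := by
    funext s
    simp [mul_add]
  map_smul' a f := by
    funext s
    simp [mul_left_comm]

theorem signDiff_apply (τ : X) (f : D.Chain R) (s : D.EnhancedState) :
    signDiff R τ f s = (-1) ^ (s.1.filter fun σ => σ < τ).card * f s := rfl

theorem signDiff_comm (σ τ : X) (f : D.Chain R) :
    signDiff R σ (signDiff R τ f) = signDiff R τ (signDiff R σ f) := by
  funext s
  simp only [signDiff_apply]
  ring

variable [Fintype X] [Finite C]

theorem MergesOrSplits.card_loop_insert (hD : D.MergesOrSplits) {τ : X} {S : Finset X}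
    (hτ : τ ∉ S) :
    (D.loopOf S (Sum.inl (τ, 0)) ≠ D.loopOf S (Sum.inl (τ, 2)) ∧
      Nat.card (D.Loop (insert τ S)) + 1 = Nat.card (D.Loop S)) ∨
    (D.loopOf S (Sum.inl (τ, 0)) = D.loopOf S (Sum.inl (τ, 2)) ∧
      Nat.card (D.Loop (insert τ S)) = Nat.card (D.Loop S) + 1) := by
  by_cases h : D.loopOf S (Sum.inl (τ, 0)) = D.loopOf S (Sum.inl (τ, 2))
  · exact Or.inr ⟨h, hD.card_loop_of_split hτ (loopAt_eq_iff.1 h)⟩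
  · exact Or.inl ⟨h, hD.card_loop_of_merge hτ fun k => h (loopAt_eq_iff.2 k)⟩

theorem MergesOrSplits.partialDiff_comm_unitChain_of_notMem (hD : D.MergesOrSplits) {τ σ : X}
    {S : Finset X} (hne : τ ≠ σ) (hτ : τ ∉ S) (hσ : σ ∉ S) :
    partialDiff R σ (partialDiff R τ (unitChain R D S)) =
      partialDiff R τ (partialDiff R σ (unitChain R D S)) := by
  have hσ₁ : σ ∉ insert τ S := by simp [hσ, hne.symm]
  have hτ₁ : τ ∉ insert σ S := by simp [hτ, hne]
  have hcomm : insert τ (insert σ S) = insert σ (insert τ S) := Finset.insert_comm _ _ _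
  have hc₁ := hD.card_loop_insert hτ
  have hc₂ := hD.card_loop_insert hσ₁
  have hc₃ := hD.card_loop_insert hσ
  have hc₄ := hD.card_loop_insert hτ₁
  rw [hcomm] at hc₄
  -- Both orders end in the same state, so the loop numbers must change by the same total. Of the
  -- sixteen combinations of merge and split six survive.
  rcases hc₁ with ⟨h₁, hc₁⟩ | ⟨h₁, hc₁⟩ <;> rcases hc₂ with ⟨h₂, hc₂⟩ | ⟨h₂, hc₂⟩ <;>
    rcases hc₃ with ⟨h₃, hc₃⟩ | ⟨h₃, hc₃⟩ <;> rcases hc₄ with ⟨h₄, hc₄⟩ | ⟨h₄, hc₄⟩ <;>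
    try omega
  · rw [hD.partialDiff_unitChain_of_merge hτ h₁, hD.partialDiff_unitChain_of_merge hσ h₃,
      hD.partialDiff_unitChain_of_merge hσ₁ h₂, hD.partialDiff_unitChain_of_merge hτ₁ h₄, hcomm]
  · rw [hD.partialDiff_unitChain_of_merge hτ h₁, hD.partialDiff_unitChain_of_merge hσ h₃,
      hD.partialDiff_unitChain_of_split hσ₁ h₂, hD.partialDiff_unitChain_of_split hτ₁ h₄, hcomm]
    have hr₁ := hD.loopOf_of_merge hτ h₁
    have hr₂ := loopOf_of_split h₂
    have hn₂ := (hD.loopOf_eq_iff hσ₁).not.2 (not_not.2 h₂)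
    have hn₄ := (hD.loopOf_eq_iff hτ₁).not.2 (not_not.2 h₄)
    rw [hcomm] at hn₄
    -- Both sites join the same two loops of `S`, so after one merges them and the other splits the
    -- result, the strands at each site lie one on each of the same two final loops.
    have key : (D.loopOf (insert σ (insert τ S)) (Sum.inl (σ, 0)) =
          D.loopOf (insert σ (insert τ S)) (Sum.inl (τ, 0)) ∧
        D.loopOf (insert σ (insert τ S)) (Sum.inl (σ, 2)) =
          D.loopOf (insert σ (insert τ S)) (Sum.inl (τ, 2))) ∨
        (D.loopOf (insert σ (insert τ S)) (Sum.inl (σ, 0)) =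
          D.loopOf (insert σ (insert τ S)) (Sum.inl (τ, 2)) ∧
        D.loopOf (insert σ (insert τ S)) (Sum.inl (σ, 2)) =
          D.loopOf (insert σ (insert τ S)) (Sum.inl (τ, 0))) := by
      clear hc₁ hc₂ hc₃ hc₄
      have e₁ := (hr₁ (Sum.inl (σ, 0)) (Sum.inl (σ, 2))).1 h₂
      have e₂ : D.loopOf (insert τ S) (Sum.inl (τ, 0)) = D.loopOf (insert τ S) (Sum.inl (σ, 0)) :=
        (hr₁ _ _).2 (by grind)
      have e₃ : D.loopOf (insert τ S) (Sum.inl (τ, 2)) = D.loopOf (insert τ S) (Sum.inl (σ, 0)) :=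
        (hr₁ _ _).2 (by grind)
      have e₄ := (hr₂ _ _).1 e₂
      have e₅ := (hr₂ _ _).1 e₃
      grind
    rcases key with ⟨k₁, k₂⟩ | ⟨k₁, k₂⟩
    · rw [mulX_unitChain_congr k₁, mulX_unitChain_congr k₂]
    · rw [mulX_unitChain_congr k₁, mulX_unitChain_congr k₂, add_comm]
  · rw [hD.partialDiff_unitChain_of_merge hτ h₁, hD.partialDiff_unitChain_of_split hσ h₃,
      hD.partialDiff_unitChain_of_split hσ₁ h₂, map_add, hD.partialDiff_mulX, hD.partialDiff_mulX,
      hD.partialDiff_unitChain_of_merge hτ₁ h₄, hcomm]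
  · rw [hD.partialDiff_unitChain_of_split hτ h₁, hD.partialDiff_unitChain_of_merge hσ h₃,
      hD.partialDiff_unitChain_of_split hτ₁ h₄, map_add, hD.partialDiff_mulX, hD.partialDiff_mulX,
      hD.partialDiff_unitChain_of_merge hσ₁ h₂, hcomm]
  · rw [hD.partialDiff_unitChain_of_split hτ h₁, hD.partialDiff_unitChain_of_split hσ h₃, map_add,
      map_add, hD.partialDiff_mulX, hD.partialDiff_mulX, hD.partialDiff_mulX, hD.partialDiff_mulX,
      hD.partialDiff_unitChain_of_merge hσ₁ h₂, hD.partialDiff_unitChain_of_merge hτ₁ h₄, hcomm]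
    have hr₁ := loopOf_of_split h₁
    have hr₂ := hD.loopOf_of_merge hσ₁ h₂
    have hn₄ := (hD.loopOf_eq_iff hτ₁).2 h₄
    have hn₂ := (hD.loopOf_eq_iff hσ₁).2 h₂
    rw [hcomm] at hn₄
    -- Each site splits a loop whose pieces the other site merges again. All strands at both sites
    -- end on this one loop, and both orders give twice multiplication by X there.
    have key : D.loopOf (insert σ (insert τ S)) (Sum.inl (σ, 0)) =
        D.loopOf (insert σ (insert τ S)) (Sum.inl (τ, 0)) := by
      clear hc₁ hc₂ hc₃ hc₄
      have e₁ := (hr₁ (Sum.inl (σ, 0)) (Sum.inl (σ, 2))).1 h₃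
      exact (hr₂ _ _).2 (by grind)
    rw [mulX_unitChain_congr key, ← mulX_unitChain_congr hn₂, ← mulX_unitChain_congr hn₄,
      mulX_unitChain_congr key]
  · rw [hD.partialDiff_unitChain_of_split hτ h₁, hD.partialDiff_unitChain_of_split hσ h₃, map_add,
      map_add, hD.partialDiff_mulX, hD.partialDiff_mulX, hD.partialDiff_mulX, hD.partialDiff_mulX,
      hD.partialDiff_unitChain_of_split hσ₁ h₂, hD.partialDiff_unitChain_of_split hτ₁ h₄, hcomm]
    simp only [map_add]
    rw [mulX_comm (Sum.inl (σ, 0)), mulX_comm (Sum.inl (σ, 0)), mulX_comm (Sum.inl (σ, 2)),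
      mulX_comm (Sum.inl (σ, 2))]
    abel

/-- On a unit the result is an operator built from multiplications by X, applied to the next unit;
the operator lets a second partial differential pass. -/
theorem MergesOrSplits.partialDiff_unitChain (hD : D.MergesOrSplits) (τ : X) (S : Finset X) :
    ∃ A : D.Chain R →ₗ[R] D.Chain R, partialDiff R τ (unitChain R D S) =
      A (unitChain R D (insert τ S)) ∧ ∀ σ f, partialDiff R σ (A f) = A (partialDiff R σ f) := by
  by_cases hτ : τ ∈ S
  · exact ⟨0, by rw [partialDiff_unitChain_of_mem hτ, LinearMap.zero_apply], by simp⟩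
  · by_cases h : D.loopOf S (Sum.inl (τ, 0)) = D.loopOf S (Sum.inl (τ, 2))
    · exact ⟨mulX R (Sum.inl (τ, 0)) + mulX R (Sum.inl (τ, 2)),
        hD.partialDiff_unitChain_of_split hτ h, fun σ f => by
          simp only [LinearMap.add_apply, map_add, hD.partialDiff_mulX]⟩
    · exact ⟨LinearMap.id, hD.partialDiff_unitChain_of_merge hτ h, fun σ f => rfl⟩

theorem MergesOrSplits.partialDiff_partialDiff_unitChain_of_mem (hD : D.MergesOrSplits) {τ σ : X}
    {S : Finset X} (hσ : σ ∈ insert τ S) :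
    partialDiff R σ (partialDiff R τ (unitChain R D S)) = 0 := by
  obtain ⟨A, hA, hA'⟩ := hD.partialDiff_unitChain (R := R) τ S
  rw [hA, hA', partialDiff_unitChain_of_mem hσ, map_zero]

theorem MergesOrSplits.partialDiff_comm_unitChain (hD : D.MergesOrSplits) (τ σ : X)
    (S : Finset X) : partialDiff R σ (partialDiff R τ (unitChain R D S)) =
      partialDiff R τ (partialDiff R σ (unitChain R D S)) := by
  rcases eq_or_ne τ σ with rfl | hne
  · rfl
  by_cases hτ : τ ∈ S
  · rw [hD.partialDiff_partialDiff_unitChain_of_mem (Finset.mem_insert_of_mem hτ),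
      partialDiff_unitChain_of_mem hτ, map_zero]
  by_cases hσ : σ ∈ S
  · rw [hD.partialDiff_partialDiff_unitChain_of_mem (Finset.mem_insert_of_mem hσ),
      partialDiff_unitChain_of_mem hσ, map_zero]
  exact hD.partialDiff_comm_unitChain_of_notMem hne hτ hσ

/-- Linear maps that commute with multiplication by `X` are determined by the units. -/
theorem ext_unitChain {A B : D.Chain R →ₗ[R] D.Chain R}
    (hA : ∀ p f, A (mulX R p f) = mulX R p (A f)) (hB : ∀ p f, B (mulX R p f) = mulX R p (B f))
    (h : ∀ S, A (unitChain R D S) = B (unitChain R D S)) : A = B := by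
  classical
  refine LinearMap.pi_ext' fun s => LinearMap.ext_ring ?_
  simp only [LinearMap.comp_apply, LinearMap.single_apply]
  induction s using induction_label with
  | h₁ S => exact h S
  | h₂ s p hp ih => rw [← mulX_single hp, hA, hB, ih]

theorem MergesOrSplits.partialDiff_comm (hD : D.MergesOrSplits) (τ σ : X) (f : D.Chain R) :
    partialDiff R σ (partialDiff R τ f) = partialDiff R τ (partialDiff R σ f) := by
  have : partialDiff R σ ∘ₗ partialDiff R τ =
      partialDiff (D := D) R τ ∘ₗ partialDiff R σ := by
    refine ext_unitChain (fun p f => ?_) (fun p f => ?_) (hD.partialDiff_comm_unitChain τ σ)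
    · simp only [LinearMap.comp_apply, hD.partialDiff_mulX]
    · simp only [LinearMap.comp_apply, hD.partialDiff_mulX]
  exact LinearMap.congr_fun this f

/-! ### The differential -/

theorem differential_eq_sum :
    D.differential R = ∑ τ : X, partialDiff R τ ∘ₗ signDiff R τ := by
  classical
  refine LinearMap.ext fun f => funext fun s' => ?_
  change ∑ s, f s * D.incidence R s s' = _
  simp only [LinearMap.sum_apply, Finset.sum_apply, LinearMap.comp_apply, partialDiff_apply,
    incidence, Finset.mul_sum]
  rw [Finset.sum_comm]
  refine Finset.sum_congr rfl fun τ _ => Finset.sum_congr rfl fun s _ => ?_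
  rw [signDiff_apply]
  split_ifs
  · ring
  · ring

/-- The partial differential adds `τ` to the `B`-sites, which changes the number of those below `σ`
exactly when τ < σ. -/
theorem signDiff_partialDiff (σ τ : X) (f : D.Chain R) :
    signDiff R σ (partialDiff R τ f) =
      (if τ < σ then -1 else 1 : R) • partialDiff R τ (signDiff R σ f) := by
  classical
  funext s'
  rw [signDiff_apply, Pi.smul_apply, partialDiff_apply, partialDiff_apply, smul_eq_mul,
    Finset.mul_sum, Finset.mul_sum]
  refine Finset.sum_congr rfl fun s _ => ?_
  by_cases h : D.IsPartialTerm τ s s'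
  · rw [if_pos h, if_pos h, signDiff_apply, h.2.1, Finset.filter_insert]
    split_ifs with hlt
    · rw [Finset.card_insert_of_notMem fun k => h.1 (Finset.mem_filter.1 k).1, pow_succ]
      ring
    · ring
  · rw [if_neg h, if_neg h, mul_zero, mul_zero]

theorem partialDiff_partialDiff_self (τ : X) (f : D.Chain R) :
    partialDiff R τ (partialDiff R τ f) = 0 := by
  classical
  funext s'
  rw [partialDiff_apply]
  refine Finset.sum_eq_zero fun s _ => ?_
  split_ifs with h
  · rw [partialDiff_apply]
    refine Finset.sum_eq_zero fun t _ => if_neg fun k => h.1 ?_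
    rw [k.2.1]
    exact Finset.mem_insert_self _ _
  · rfl

theorem MergesOrSplits.differential_comp_self (hD : D.MergesOrSplits) :
    D.differential R ∘ₗ D.differential R = 0 := by
  refine LinearMap.ext fun f => ?_
  simp only [differential_eq_sum, LinearMap.comp_apply, LinearMap.sum_apply, map_sum,
    LinearMap.zero_apply]
  rw [← Finset.sum_product']
  -- The terms for (σ, τ) and (τ, σ) have opposite signs and cancel; the diagonal terms vanish since
  -- a site cannot be resmoothed twice.
  refine Finset.sum_involution (fun x _ => (x.2, x.1)) ?_ ?_ (fun _ _ => by simp) fun _ _ => rfl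
  · rintro ⟨σ, τ⟩ -
    simp only [signDiff_partialDiff, map_smul]
    rw [hD.partialDiff_comm τ σ, signDiff_comm σ τ]
    rcases lt_trichotomy σ τ with h | rfl | h
    · simp [h, h.not_gt]
    · simp [partialDiff_partialDiff_self]
    · simp [h, h.not_gt]
  · rintro ⟨σ, τ⟩ - h k
    apply h
    obtain rfl : τ = σ := congrArg Prod.fst k
    simp [signDiff_partialDiff, partialDiff_partialDiff_self]

theorem MergesOrSplits.map_chainGroup_le (hD : D.MergesOrSplits) (i j : ℤ) :
    (D.chainGroup R i j).map (D.differential R) ≤ D.chainGroup R (i + 1) j := by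
  classical
  rintro _ ⟨f, hf, rfl⟩ s' hs'
  change ∑ s, f s * D.incidence R s s' = 0
  refine Finset.sum_eq_zero fun s _ => ?_
  by_cases hs : (s.nB : ℤ) = i ∧ s.jdeg = j
  · rw [incidence, Finset.sum_eq_zero, mul_zero]
    refine fun τ _ => if_neg fun h => hs' ⟨?_, ?_⟩
    · rw [h.nB_eq, ← hs.1]
      push_cast
      ring
    · rw [hD.jdeg_eq h, hs.2]
  · rw [hf s hs, zero_mul]

end LinkDiagram

namespace LinkDiagram

open EnhancedState

variable {X C : Type*} [Fintype X] [LinearOrder X]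
variable {R : Type*} [CommRing R] {D : LinkDiagram X C}

theorem EnhancedState.nB_lt (s : D.EnhancedState) : s.nB < Fintype.card X + 1 :=
  Nat.lt_succ_of_le (Finset.card_le_univ s.1)

theorem chainGroup_eq_bot {i : ℤ} (j : ℤ) (hi : i < 0 ∨ (Fintype.card X : ℤ) < i) :
    D.chainGroup R i j = ⊥ := by
  rw [eq_bot_iff]
  intro f hf
  refine funext fun s => hf s fun h => ?_
  have := s.nB_lt
  omega

variable [Finite C]

/-! ### Ranks of the chain groups -/

open Classical in
variable (R D) in
/-- `C^{ij}` is free on the enhanced states of degree `i, j`. -/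
noncomputable def chainGroupEquiv (i j : ℤ) : D.chainGroup R i j ≃ₗ[R]
    ({s : D.EnhancedState // (s.nB : ℤ) = i ∧ s.jdeg = j} → R) where
  toFun f s := f.1 s.1
  map_add' _ _ := rfl
  map_smul' _ _ := rfl
  invFun g := ⟨fun s => if h : (s.nB : ℤ) = i ∧ s.jdeg = j then g ⟨s, h⟩ else 0,
    fun _ hs => dif_neg hs⟩
  left_inv f := by
    refine Subtype.ext (funext fun s => ?_)
    by_cases h : (s.nB : ℤ) = i ∧ s.jdeg = j
    · exact dif_pos h
    · exact (dif_neg h).trans (f.2 s h).symm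
  right_inv g := funext fun s => dif_pos s.2

instance chainGroup_finite (i j : ℤ) : Module.Finite R (D.chainGroup R i j) :=
  Module.Finite.equiv (chainGroupEquiv R D i j).symm

open Classical in
theorem finrank_chainGroup [Nontrivial R] (i j : ℤ) : Module.finrank R (D.chainGroup R i j) =
    (Finset.univ.filter fun s : D.EnhancedState => (s.nB : ℤ) = i ∧ s.jdeg = j).card := by
  rw [(chainGroupEquiv R D i j).finrank_eq, Module.finrank_fintype_fun_eq_card,
    Fintype.card_subtype]

variable (R) in
open Classical in
theorem chiRho_eq_sum [Nontrivial R] (ρ : ℂ) (j : ℤ) : D.chiRho R ρ j =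
    ∑ s : D.EnhancedState, if s.jdeg = j then (-ρ) ^ s.nB else 0 := by
  simp only [chiRho, finrank_chainGroup, Finset.card_filter, Nat.cast_sum, Finset.mul_sum]
  rw [Finset.sum_comm]
  refine Finset.sum_congr rfl fun s _ => ?_
  rw [Finset.sum_eq_single_of_mem s.nB (Finset.mem_range.2 s.nB_lt)]
  · by_cases h : s.jdeg = j <;> simp [h]
  · intro i _ hi
    simp [hi.symm]

variable (R D) in
theorem chiRho_support_subset [Nontrivial R] (ρ : ℂ) :
    (Function.support fun j : ℤ => D.chiRho R ρ j) ⊆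
      ((Finset.univ.image fun s : D.EnhancedState => s.jdeg : Finset ℤ) : Set ℤ) := by
  intro j hj
  by_contra h
  apply hj
  dsimp only
  rw [chiRho_eq_sum]
  refine Finset.sum_eq_zero fun s _ => if_neg fun k => h ?_
  rw [← k]
  simp

variable (R) in
theorem finsum_chiRho [Nontrivial R] (q ρ : ℂ) : ∑ᶠ j : ℤ, q ^ j * D.chiRho R ρ j =
    ∑ s : D.EnhancedState, (-ρ) ^ s.nB * q ^ s.jdeg := by
  classical
  rw [finsum_eq_sum_of_support_subset (s := Finset.univ.image fun s : D.EnhancedState => s.jdeg)]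
  · simp only [chiRho_eq_sum, Finset.mul_sum]
    rw [Finset.sum_comm]
    refine Finset.sum_congr rfl fun s _ => ?_
    rw [Finset.sum_eq_single_of_mem s.jdeg (Finset.mem_image_of_mem _ (Finset.mem_univ s))]
    · simp [mul_comm]
    · intro j _ hj
      simp [hj.symm]
  · exact (Function.support_mul_subset_right _ _).trans (chiRho_support_subset R D ρ)

/-! ### Expansion of the `ρ`-bracket -/

theorem _root_.zpow_sum₀ {ι K : Type*} [Field K] {q : K} (hq : q ≠ 0) (t : Finset ι) (f : ι → ℤ) :
    q ^ (∑ i ∈ t, f i) = ∏ i ∈ t, q ^ f i := by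
  classical
  induction t using Finset.induction_on with
  | empty => simp
  | insert a t ha ih => rw [Finset.sum_insert ha, Finset.prod_insert ha, zpow_add₀ hq, ih]

variable (D) in
/-- The enhanced state with given labels on the loops of the state `S`. -/
def EnhancedState.ofLabels (S : Finset X) (a : D.Loop S → LoopLabel) : D.EnhancedState := ⟨S, a⟩

/-- Expanding the product over the loops of q + q⁻¹ amounts to choosing a label on each loop. -/
theorem sum_labels (S : Finset X) {q : ℂ} (hq : q ≠ 0) [Fintype (D.Loop S → LoopLabel)] :
    ∑ a : D.Loop S → LoopLabel, q ^ (ofLabels D S a).lam =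
      (q + q⁻¹) ^ Nat.card (D.Loop S) := by
  classical
  have inst : Fintype (D.Loop S) := Fintype.ofFinite _
  have h : ∀ a : D.Loop S → LoopLabel, q ^ (ofLabels D S a).lam =
      ∏ l, if a l = LoopLabel.one then q else q⁻¹ := by
    intro a
    rw [lam_eq_sum (ofLabels D S a) inst, zpow_sum₀ hq]
    refine Finset.prod_congr rfl fun l _ => ?_
    change q ^ (if a l = LoopLabel.one then (1 : ℤ) else -1) = _
    by_cases h : a l = LoopLabel.one <;> simp [h]
  simp only [h]
  have := Finset.prod_univ_sum (fun _ : D.Loop S => (Finset.univ : Finset LoopLabel))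
    (fun _ x => if x = LoopLabel.one then q else q⁻¹)
  rw [Fintype.piFinset_univ] at this
  rw [Nat.card_eq_fintype_card]
  convert this.symm using 1
  · exact Finset.sum_congr (Finset.ext fun a => by simp) fun _ _ => rfl
  · rw [Finset.prod_const, Finset.card_univ]
    congr 1
    simp [Finset.univ, Fintype.elems]

theorem sum_enhancedState {M : Type*} [AddCommMonoid M] (F : D.EnhancedState → M)
    [∀ S, Fintype (D.Loop S → LoopLabel)] :
    ∑ s, F s = ∑ S : Finset X, ∑ a : D.Loop S → LoopLabel, F (ofLabels D S a) := by
  rw [Finset.sum_sigma' Finset.univ (fun _ => Finset.univ)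
    fun (S : Finset X) (a : D.Loop S → LoopLabel) => F (ofLabels D S a), Finset.univ_sigma_univ]
  let e : D.EnhancedState ≃ Σ S : Finset X, (D.Loop S → LoopLabel) := Equiv.refl _
  exact Fintype.sum_equiv e F
    (fun s => F (ofLabels D s.1 s.2)) fun _ => rfl

theorem rhoBracket_eq_sum {q : ℂ} (hq : q ≠ 0) (ρ : ℂ) :
    D.rhoBracket q ρ = ∑ s : D.EnhancedState, (-ρ) ^ s.nB * q ^ s.jdeg := by
  have inst : ∀ S, Fintype (D.Loop S → LoopLabel) := fun S => Fintype.ofFinite _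
  rw [sum_enhancedState fun s : D.EnhancedState => (-ρ) ^ s.nB * q ^ s.jdeg, rhoBracket, bracket]
  refine Finset.sum_congr rfl fun S _ => ?_
  rw [← sum_labels S hq, Finset.mul_sum]
  refine Finset.sum_congr rfl fun a _ => ?_
  have hn : (ofLabels D S a).nB = S.card := rfl
  rw [jdeg, zpow_add₀ hq, hn, zpow_natCast, ← mul_assoc, ← mul_pow]
  congr 2
  ring

/-! ### Euler characteristics -/

theorem MergesOrSplits.boundaries_le_cycles (hD : D.MergesOrSplits) (i j : ℤ) :
    D.boundaries R i j ≤ D.cycles R i j := by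
  refine le_inf ?_ ?_
  · have := hD.map_chainGroup_le (R := R) (i - 1) j
    rwa [sub_add_cancel] at this
  · rintro _ ⟨f, -, rfl⟩
    exact LinearMap.congr_fun (hD.differential_comp_self (R := R)) f

/-- A domain need not be Noetherian, so submodules of chain groups need not be finitely generated;
finiteness of the rank suffices to pass from cardinals to natural numbers. -/
theorem _root_.Submodule.finrank_quotient_add_finrank_of_rank_lt {R M : Type*} [CommRing R]
    [IsDomain R] [AddCommGroup M] [Module R M] (h : Module.rank R M < Cardinal.aleph0)
    (N : Submodule R M) :
    Module.finrank R (M ⧸ N) + Module.finrank R N = Module.finrank R M := by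
  have h₁ := HasRankNullity.rank_quotient_add_rank N
  have h₂ : Module.rank R (M ⧸ N) < Cardinal.aleph0 :=
    lt_of_le_of_lt (h₁ ▸ self_le_add_right _ _) h
  have h₃ : Module.rank R N < Cardinal.aleph0 := lt_of_le_of_lt (h₁ ▸ self_le_add_left _ _) h
  rw [Module.finrank, Module.finrank, Module.finrank, ← Cardinal.toNat_add h₂ h₃, h₁]

variable [IsDomain R]

variable (R D) in
theorem finrank_cycles_add_finrank_boundaries (i j : ℤ) :
    Module.finrank R (D.cycles R i j) + Module.finrank R (D.boundaries R (i + 1) j) =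
      Module.finrank R (D.chainGroup R i j) := by
  set f := (D.differential R).domRestrict (D.chainGroup R i j) with hf
  have h₁ := (LinearMap.ker f).finrank_quotient_add_finrank
  rw [LinearEquiv.finrank_eq f.quotKerEquivRange, LinearMap.range_domRestrict] at h₁
  have h₂ : Module.finrank R (LinearMap.ker f) = Module.finrank R (D.cycles R i j) := by
    have : D.cycles R i j = (LinearMap.ker f).map (D.chainGroup R i j).subtype := by
      rw [hf, LinearMap.ker_domRestrict, Submodule.map_comap_subtype]
      rfl
    rw [this]
    exact ((D.chainGroup R i j).equivSubtypeMap _).finrank_eq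
  rw [boundaries, add_sub_cancel_right, ← h₁, h₂, add_comm]

theorem MergesOrSplits.finrank_homology_add_finrank_boundaries (hD : D.MergesOrSplits)
    (i j : ℤ) : Module.finrank R (D.Homology R i j) + Module.finrank R (D.boundaries R i j) =
      Module.finrank R (D.cycles R i j) := by
  have hlt : Module.rank R (D.cycles R i j) < Cardinal.aleph0 :=
    (Submodule.rank_le _).trans_lt (Module.rank_lt_aleph0 R (D.Chain R))
  rw [← Submodule.finrank_quotient_add_finrank_of_rank_lt hlt,
    (Submodule.submoduleOfEquivOfLe (hD.boundaries_le_cycles i j)).finrank_eq]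

/-- With b_i the rank of the boundaries in degree i, rank C^i = rank H^i + b_{i+1} + b_i, and the
alternating sum of the b-terms telescopes. -/
theorem MergesOrSplits.chiRho_one (hD : D.MergesOrSplits) (j : ℤ) :
    D.chiRho R 1 j = (D.chiHomology R j : ℂ) := by
  set b : ℕ → ℤ := fun i => Module.finrank R (D.boundaries R (i : ℤ) j) with hb
  have hstep : ∀ i : ℕ, (Module.finrank R (D.chainGroup R (i : ℤ) j) : ℤ) =
      Module.finrank R (D.Homology R (i : ℤ) j) + (b (i + 1) + b i) := by
    intro i
    have h₁ := finrank_cycles_add_finrank_boundaries R D i j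
    have h₂ := hD.finrank_homology_add_finrank_boundaries (R := R) i j
    simp only [hb]
    push_cast
    omega
  have htel : ∀ n : ℕ, ∑ i ∈ Finset.range n, (-1 : ℤ) ^ i * (b (i + 1) + b i) =
      b 0 - (-1) ^ n * b n := by
    intro n
    induction n with
    | zero => simp
    | succ n ih =>
      rw [Finset.sum_range_succ, ih, pow_succ]
      ring
  have hb₀ : b 0 = 0 := by
    have h : D.boundaries R ((0 : ℕ) : ℤ) j = ⊥ := by
      rw [boundaries, chainGroup_eq_bot j (Or.inl (by simp)), Submodule.map_bot]
    simp only [hb]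
    rw [h, finrank_bot, Nat.cast_zero]
  -- Boundaries in this degree lie in a chain group beyond the number of crossings, which is zero.
  have hb₁ : b (Fintype.card X + 1) = 0 := by
    have h : D.boundaries R ((Fintype.card X + 1 : ℕ) : ℤ) j = ⊥ := by
      rw [eq_bot_iff, ← chainGroup_eq_bot (R := R) (D := D) j
        (i := ((Fintype.card X + 1 : ℕ) : ℤ)) (Or.inr (by simp))]
      exact (hD.boundaries_le_cycles _ j).trans inf_le_left
    simp only [hb]
    rw [h, finrank_bot, Nat.cast_zero]
  have key : ∑ i ∈ Finset.range (Fintype.card X + 1),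
      (-1 : ℤ) ^ i * (Module.finrank R (D.chainGroup R (i : ℤ) j) : ℤ) = D.chiHomology R j := by
    have h := htel (Fintype.card X + 1)
    rw [hb₀, hb₁, mul_zero, sub_zero] at h
    simp only [hstep, mul_add (_ ^ _) (Module.finrank R (D.Homology R _ j) : ℤ),
      Finset.sum_add_distrib]
    rw [h, add_zero, chiHomology]
  rw [← key, chiRho]
  push_cast
  rfl

end LinkDiagram

/-! ### The Potts partition function -/

namespace PlaneGraph

variable {V E : Type*} (G : PlaneGraph V E)

/-- Spin states that agree along the edges in `S` are functions on the components. -/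
def agreeEquiv (S : Finset E) (α : Type*) :
    {σ : V → α // ∀ e ∈ S, σ (G.vert (e, false)) = σ (G.vert (e, true))} ≃
      (Quotient (G.component S) → α) where
  toFun σ := Quotient.lift σ.1 fun x y h =>
    G.component_le (t := Setoid.ker σ.1) (fun e he => σ.2 e he) h
  invFun f := ⟨fun x => f (Quotient.mk _ x), fun _ he =>
    congrArg f (Quotient.sound (G.component_edge he))⟩
  left_inv _ := rfl
  right_inv f := funext fun c => by
    induction c using Quotient.inductionOn with | _ x
    rfl

variable [Fintype V] [DecidableEq V]

theorem card_agree (S : Finset E) (Q : ℕ) [DecidablePred fun σ : V → Fin Q =>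
    ∀ e ∈ S, σ (G.vert (e, false)) = σ (G.vert (e, true))] :
    (Finset.univ.filter fun σ : V → Fin Q =>
      ∀ e ∈ S, σ (G.vert (e, false)) = σ (G.vert (e, true))).card =
      Q ^ Nat.card (Quotient (G.component S)) := by
  classical
  rw [← Fintype.card_subtype, ← Nat.card_eq_fintype_card, Nat.card_congr (G.agreeEquiv S (Fin Q)),
    Nat.card_fun, Nat.card_fin]

variable [Fintype E]

/-- The expansion of the partition function over spanning subgraphs. -/
theorem sum_pow_energy (Q : ℕ) (x : ℂ) : ∑ σ : V → Fin Q, x ^ G.energy σ =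
    ∑ S : Finset E, (x - 1) ^ S.card * (Q : ℂ) ^ Nat.card (Quotient (G.component S)) := by
  classical
  have h : ∀ σ : V → Fin Q, x ^ G.energy σ = ∑ S : Finset E, (x - 1) ^ S.card *
      if ∀ e ∈ S, σ (G.vert (e, false)) = σ (G.vert (e, true)) then 1 else 0 := by
    intro σ
    calc x ^ G.energy σ
        -- Each agreeing edge contributes x = 1 + (x − 1). In the expanded product the set `S`
        -- survives exactly when the spins agree along all of `S`.
        = ∏ e : E, (1 + if σ (G.vert (e, false)) = σ (G.vert (e, true)) then x - 1 else 0) := by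
          rw [energy, ← Finset.prod_const, Finset.prod_filter]
          refine Finset.prod_congr rfl fun e _ => ?_
          split_ifs <;> ring
      _ = ∑ S : Finset E,
          ∏ e ∈ S, (if σ (G.vert (e, false)) = σ (G.vert (e, true)) then x - 1 else 0) := by
          rw [Finset.prod_one_add, Finset.powerset_univ]
      _ = _ := by
          refine Finset.sum_congr rfl fun S _ => ?_
          rw [Finset.prod_ite_zero, Finset.prod_const]
          split_ifs <;> simp
  simp only [h]
  rw [Finset.sum_comm]
  refine Finset.sum_congr rfl fun S _ => ?_
  rw [← Finset.mul_sum, Finset.sum_boole, card_agree, Nat.cast_pow]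

/-- Euler's formula gives r^{ℓ(S)} r^N = Q^{k(S)} r^{|S|}, so the two sums agree term by term. -/
theorem sum_pow_energy_eq_bracket [DecidableEq E] {Q : ℕ} {r : ℂ} (hr : r ^ 2 = (Q : ℂ))
    (hr₀ : r ≠ 0) (x : ℂ) : ∑ σ : V → Fin Q, x ^ G.energy σ =
      r ^ Fintype.card V * G.linkDiagram.bracket (r⁻¹ * (x - 1)) r := by
  rw [sum_pow_energy, LinkDiagram.bracket, Finset.mul_sum]
  refine Finset.sum_congr rfl fun S _ => ?_
  have h := G.card_loop_add_card S
  rw [Nat.card_eq_fintype_card (α := V)] at h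
  have h' : r ^ Nat.card (G.linkDiagram.Loop S) * r ^ Fintype.card V =
      (r ^ 2) ^ Nat.card (Quotient (G.component S)) * r ^ S.card := by
    rw [← pow_add, h, pow_add, pow_mul]
  rw [mul_pow, inv_pow, ← hr]
  field_simp
  linear_combination (-(x - 1) ^ S.card) * h'

theorem potts_eq_sum (Q : ℕ) (K : ℂ) :
    G.potts Q K = ∑ σ : V → Fin Q, Complex.exp K ^ G.energy σ := by
  refine Finset.sum_congr rfl fun σ _ => ?_
  rw [← Complex.exp_nat_mul, mul_comm]

end PlaneGraph

theorem LinkDiagram.bracket_one {X C : Type*} [Fintype X] [DecidableEq X] (D : LinkDiagram X C)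
    (b : ℂ) : D.bracket b 1 = (1 + b) ^ Fintype.card X := by
  rw [bracket, ← Finset.card_univ, ← Finset.prod_const, Finset.prod_one_add, Finset.powerset_univ]
  simp

/-! ### The value `ρ = 1` -/

/-- The bracket at the loop values `1` and `√5` determines `ρ = 1`. -/
theorem PlaneGraph.eq_one_of_rhoBracket_eq {V E : Type*} [Fintype V] [DecidableEq V] [Fintype E]
    [DecidableEq E] [Nonempty E] (G : PlaneGraph V E) {ρ : ℂ}
    (h : ∀ q : ℂ, q ≠ 0 → G.linkDiagram.rhoBracket q ρ = G.linkDiagram.rhoBracket q 1) :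
    ρ = 1 := by
  have hcard : Fintype.card E ≠ 0 := Fintype.card_ne_zero
  have h3 : (Real.sqrt 3) ^ 2 = 3 := Real.sq_sqrt (by norm_num)
  have key : ∀ t : ℝ, t ^ 2 = 3 → ρ.re ^ 2 + ρ.im ^ 2 = ρ.re - t * ρ.im := by
    intro t ht
    -- A primitive sixth root of unity, for which the loop value is 1 and |1 − q| = 1. Comparing
    -- norms gives |1 − qρ| = 1, a circle through 0 and 1; the two signs of `t` give two circles.
    set q : ℂ := ⟨1 / 2, t / 2⟩ with hq
    have hmul : q * ⟨1 / 2, -(t / 2)⟩ = 1 := by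
      apply Complex.ext
      · simp [hq]
        nlinarith
      · simp [hq]
        ring
    have hq₀ : q ≠ 0 := left_ne_zero_of_mul_eq_one hmul
    have hinv : q⁻¹ = ⟨1 / 2, -(t / 2)⟩ := inv_eq_of_mul_eq_one_right hmul
    have hsum : q + q⁻¹ = 1 := by
      rw [hinv]
      apply Complex.ext <;> simp [hq]
      norm_num
    have h₁ := h q hq₀
    rw [LinkDiagram.rhoBracket, LinkDiagram.rhoBracket, hsum, LinkDiagram.bracket_one,
      LinkDiagram.bracket_one] at h₁
    have h₂ := congrArg norm h₁
    rw [norm_pow, norm_pow] at h₂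
    have h₃ := (pow_left_inj₀ (norm_nonneg _) (norm_nonneg _) hcard).1 h₂
    have h₄ := congrArg (· ^ 2) h₃
    simp only [Complex.sq_norm, Complex.normSq_apply] at h₄
    simp [hq] at h₄
    nlinarith
  have k₁ := key _ h3
  have k₂ := key (-Real.sqrt 3) (by rw [neg_sq, h3])
  have him : ρ.im = 0 := by
    have : Real.sqrt 3 * ρ.im = 0 := by linarith
    rcases mul_eq_zero.1 this with k | k
    · rw [k] at h3
      norm_num at h3
    · exact k
  have hre : ρ.re = 0 ∨ ρ.re = 1 := by
    have : ρ.re * (ρ.re - 1) = 0 := by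
      rw [him] at k₁
      linarith
    rcases mul_eq_zero.1 this with k | k
    · exact Or.inl k
    · exact Or.inr (by linarith)
  rcases hre with hre | hre
  · exfalso
    have hρ : ρ = 0 := Complex.ext hre him
    subst hρ
    -- Here Q = 5 and √Q = t, with q = (t − 1)/2 and q⁻¹ = (t + 1)/2. The value ρ = 0 corresponds to
    -- e^K = 1, and ρ = 1 to 1 − tq = (t − 3)/2, which has absolute value below 1.
    set t : ℝ := Real.sqrt 5 with ht
    have ht2 : t ^ 2 = 5 := Real.sq_sqrt (by norm_num)
    have htl : 2 < t := by
      rw [ht]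
      exact Real.lt_sqrt_of_sq_lt (by norm_num)
    have htu : t < 3 := by
      rw [ht]
      exact (Real.sqrt_lt' (by norm_num)).2 (by norm_num)
    have htC : (t : ℂ) ^ 2 = ((5 : ℕ) : ℂ) := by exact_mod_cast ht2
    have htC' : (t : ℂ) ^ 2 = 5 := by exact_mod_cast ht2
    have ht₀ : (t : ℂ) ≠ 0 := by
      have : t ≠ 0 := by linarith
      exact_mod_cast this
    set q : ℂ := (((t - 1) / 2 : ℝ) : ℂ) with hq
    have hmul : q * ((t + 1) / 2 : ℝ) = 1 := by
      rw [hq]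
      push_cast
      linear_combination htC' / 4
    have hq₀ : q ≠ 0 := left_ne_zero_of_mul_eq_one hmul
    have hinv : q⁻¹ = ((t + 1) / 2 : ℝ) := inv_eq_of_mul_eq_one_right hmul
    have hsum : q + q⁻¹ = t := by
      rw [hinv, hq]
      push_cast
      ring
    have h₁ := h q hq₀
    rw [LinkDiagram.rhoBracket, LinkDiagram.rhoBracket, hsum] at h₁
    have e₀ := G.sum_pow_energy_eq_bracket htC ht₀ 1
    have e₁ := G.sum_pow_energy_eq_bracket htC ht₀ (((t - 3) / 2 : ℝ) : ℂ)
    rw [show (t : ℂ)⁻¹ * (1 - 1) = -(q * 0) by ring, h₁] at e₀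
    rw [show (t : ℂ)⁻¹ * ((((t - 3) / 2 : ℝ) : ℂ) - 1) = -(q * 1) by
      rw [hq]
      push_cast
      field_simp
      linear_combination htC', ← e₀] at e₁
    have hx : |(t - 3) / 2| < 1 := by
      rw [abs_lt]
      constructor <;> linarith
    have e₂ : ∑ σ : V → Fin 5, ((t - 3) / 2) ^ G.energy σ = ∑ _σ : V → Fin 5, (1 : ℝ) := by
      have : ((∑ σ : V → Fin 5, ((t - 3) / 2) ^ G.energy σ : ℝ) : ℂ) =
          ((∑ _σ : V → Fin 5, (1 : ℝ) : ℝ) : ℂ) := by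
        push_cast
        push_cast at e₁
        rw [e₁]
        simp
      exact_mod_cast this
    -- The inequality is strict at the constant colouring, whose energy is the positive number of
    -- edges.
    have e₃ : ∑ σ : V → Fin 5, ((t - 3) / 2) ^ G.energy σ < ∑ _σ : V → Fin 5, (1 : ℝ) := by
      refine Finset.sum_lt_sum (fun σ _ => ?_) ⟨fun _ => 0, Finset.mem_univ _, ?_⟩
      · refine (le_abs_self _).trans ?_
        rw [abs_pow]
        exact pow_le_one₀ (abs_nonneg _) hx.le
      · refine (le_abs_self _).trans_lt ?_
        rw [abs_pow]
        refine pow_lt_one₀ (abs_nonneg _) hx ?_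
        simp [PlaneGraph.energy]
    exact e₃.ne e₂
  · exact Complex.ext hre him

/-! ### The change of variables -/

namespace IsPottsParam

variable {Q : ℕ} {K r q ρ : ℂ}

theorem root_ne_zero {Q : ℕ} (hQ : 1 ≤ Q) {r : ℂ} (hr : r ^ 2 = (Q : ℂ)) : r ≠ 0 := by
  rintro rfl
  have : (Q : ℂ) = 0 := by rw [← hr]; ring
  have := Nat.cast_eq_zero.1 this
  omega

theorem exists_of_root (K : ℂ) (hr : r ^ 2 = (Q : ℂ)) :
    ∃ q ρ, IsPottsParam Q K r q ρ := by
  -- The equation for q is q² − rq + 1 = 0, with discriminant r² − 4 = Q − 4.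
  obtain ⟨w, hw⟩ := IsAlgClosed.exists_pow_nat_eq ((Q : ℂ) - 4) (n := 2) (by norm_num)
  have hmul : (r + w) / 2 * ((r - w) / 2) = 1 := by linear_combination (hr - hw) / 4
  have hq : (r + w) / 2 ≠ 0 := left_ne_zero_of_mul_eq_one hmul
  have hinv : ((r + w) / 2)⁻¹ = (r - w) / 2 := inv_eq_of_mul_eq_one_right hmul
  refine ⟨(r + w) / 2, -(r⁻¹ * (Complex.exp K - 1)) / ((r + w) / 2), hr, hq, ?_, ?_⟩
  · rw [hinv]
    ring
  · rw [mul_div_cancel₀ _ hq, neg_neg]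

theorem exists_discriminant (h : IsPottsParam Q K r q ρ) :
    ∃ w : ℂ, w ^ 2 = (Q : ℂ) - 4 ∧ q = (r + w) / 2 ∧ q⁻¹ = (r - w) / 2 := by
  have hq := h.q_ne
  refine ⟨q - q⁻¹, ?_, ?_, ?_⟩
  · rw [← h.sq_root, ← h.loop_value]
    field_simp
    ring
  · rw [← h.loop_value]
    ring
  · rw [← h.loop_value]
    ring

/-- From ρ = −v q⁻¹/r and q⁻¹ = (r − w)/2 one reads off u = w/r. -/
theorem exists_rho (hQ : 1 ≤ Q) (h : IsPottsParam Q K r q ρ) :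
    ∃ u : ℂ, u ^ 2 = 1 - 4 / (Q : ℂ) ∧ ρ = (Complex.exp K - 1) * ((-1 + u) / 2) := by
  obtain ⟨w, hw, hq, hq'⟩ := h.exists_discriminant
  have hr := root_ne_zero hQ h.sq_root
  have hQ₀ : (Q : ℂ) ≠ 0 := by rw [← h.sq_root]; exact pow_ne_zero 2 hr
  refine ⟨w / r, ?_, ?_⟩
  · rw [div_pow, hw, h.sq_root]
    field_simp
  · have h₁ : ρ = -(q⁻¹ * (r⁻¹ * (Complex.exp K - 1))) := by
      rw [← h.site_value]
      have := h.q_ne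
      field_simp
    rw [h₁, hq']
    field_simp
    ring

/-- At ρ = 1 the site equation reads e^K − 1 = −qr, and qr = q² + 1. -/
theorem one_iff (hQ : 1 ≤ Q) : IsPottsParam Q K r q 1 ↔
    r ^ 2 = (Q : ℂ) ∧ q ≠ 0 ∧ q + q⁻¹ = r ∧ Complex.exp K = -q ^ 2 := by
  constructor
  · intro h
    refine ⟨h.sq_root, h.q_ne, h.loop_value, ?_⟩
    have hr := root_ne_zero hQ h.sq_root
    have h₁ := h.site_value
    have h₂ : Complex.exp K - 1 = -(r * q) := by
      field_simp at h₁
      linear_combination -h₁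
    rw [← h.loop_value] at h₂
    have hq := h.q_ne
    have h₃ : (q + q⁻¹) * q = q ^ 2 + 1 := by field_simp
    linear_combination h₂ - h₃
  · rintro ⟨h₁, h₂, h₃, h₄⟩
    refine ⟨h₁, h₂, h₃, ?_⟩
    have hr := root_ne_zero hQ h₁
    rw [h₄, mul_one, eq_inv_mul_iff_mul_eq₀ hr, ← h₃]
    field_simp
    ring

theorem exists_one_iff (hQ : 1 ≤ Q) : (∃ r q, IsPottsParam Q K r q 1) ↔
    ∃ r w : ℂ, r ^ 2 = (Q : ℂ) ∧ w ^ 2 = (Q : ℂ) - 4 ∧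
      Complex.exp K = (2 - (Q : ℂ) - r * w) / 2 := by
  constructor
  · rintro ⟨r, q, h⟩
    obtain ⟨w, hw, hq, -⟩ := h.exists_discriminant
    refine ⟨r, w, h.sq_root, hw, ?_⟩
    rw [((one_iff hQ).1 h).2.2.2, hq]
    linear_combination (-1 / 4) * h.sq_root - hw / 4
  · rintro ⟨r, w, hr, hw, hK⟩
    have hmul : (r + w) / 2 * ((r - w) / 2) = 1 := by linear_combination (hr - hw) / 4
    refine ⟨r, (r + w) / 2, (one_iff hQ).2 ⟨hr, left_ne_zero_of_mul_eq_one hmul, ?_, ?_⟩⟩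
    · rw [inv_eq_of_mul_eq_one_right hmul]
      ring
    · rw [hK]
      linear_combination (1 / 4) * hr + hw / 4

/-- The values of `e^K` at `ρ = 1` in terms of one product `√Q √(Q - 4)`. -/
theorem exists_one_iff_of_sq (hQ : 1 ≤ Q) {d : ℂ} (hd : d ^ 2 = (Q : ℂ) * ((Q : ℂ) - 4)) :
    (∃ r q, IsPottsParam Q K r q 1) ↔
      Complex.exp K = (2 - (Q : ℂ) - d) / 2 ∨ Complex.exp K = (2 - (Q : ℂ) + d) / 2 := by
  rw [exists_one_iff hQ]
  constructor
  · rintro ⟨r, w, hr, hw, hK⟩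
    have : (r * w) ^ 2 = d ^ 2 := by rw [mul_pow, hr, hw, hd]
    rcases sq_eq_sq_iff_eq_or_eq_neg.1 this with h | h
    · left
      rw [hK, h]
    · right
      rw [hK, h, sub_neg_eq_add]
  · intro h
    obtain ⟨r, hr⟩ := IsAlgClosed.exists_pow_nat_eq (Q : ℂ) (n := 2) (by norm_num)
    have hr₀ := root_ne_zero hQ hr
    have hdr : (d / r) ^ 2 = (Q : ℂ) - 4 := by
      rw [div_pow, hd, ← hr]
      field_simp
    rcases h with h | h
    · exact ⟨r, d / r, hr, hdr, by rw [h, mul_div_cancel₀ _ hr₀]⟩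
    · exact ⟨r, -(d / r), hr, by rw [neg_sq, hdr], by
        rw [h, mul_neg, mul_div_cancel₀ _ hr₀, sub_neg_eq_add]⟩

/-- For real K the number q² = −e^K is negative, whereas Q q² = (q² + 1)² would be the square of a
real number. -/
theorem im_ne_zero (hQ : 1 ≤ Q) (h : IsPottsParam Q K r q 1) : K.im ≠ 0 := by
  intro him
  obtain ⟨h₁, h₂, h₃, h₄⟩ := (one_iff hQ).1 h
  obtain ⟨x, rfl⟩ : ∃ x : ℝ, K = x := ⟨K.re, Complex.ext rfl him⟩
  rw [← Complex.ofReal_exp] at h₄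
  have h₅ : (q + q⁻¹) ^ 2 * q ^ 2 = (q ^ 2 + 1) ^ 2 := by
    field_simp
  rw [h₃, h₁, show q ^ 2 = -(Real.exp x : ℂ) by rw [h₄, neg_neg]] at h₅
  have h₆ : (Q : ℝ) * -Real.exp x = (-Real.exp x + 1) ^ 2 := by exact_mod_cast h₅
  have h₇ : 0 < (Q : ℝ) * Real.exp x := mul_pos (by exact_mod_cast hQ) (Real.exp_pos x)
  nlinarith [sq_nonneg (-Real.exp x + 1)]

theorem im_temperature_ne_zero (hK : K.im ≠ 0) {J k : ℝ} {T : ℂ}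
    (h : K = (J : ℂ) / ((k : ℂ) * T)) : T.im ≠ 0 := by
  intro him
  obtain ⟨x, rfl⟩ : ∃ x : ℝ, T = x := ⟨T.re, Complex.ext rfl him⟩
  apply hK
  rw [h, ← Complex.ofReal_mul, ← Complex.ofReal_div, Complex.ofReal_im]

end IsPottsParam

/-! ### Negative real values of e^K and the critical point -/

namespace IsPottsParam

variable {Q : ℕ} {K r q ρ : ℂ}

theorem exists_neg_real (hQ : 4 < Q) (h : ∃ r q, IsPottsParam Q K r q 1) :
    ∃ x : ℝ, x < 0 ∧ Complex.exp K = (x : ℂ) := by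
  have hQ' : (4 : ℝ) < Q := by exact_mod_cast hQ
  set d : ℝ := Real.sqrt (Q * (Q - 4)) with hd
  have hnn : (0 : ℝ) ≤ Q * (Q - 4) := mul_nonneg (by linarith) (by linarith)
  have hd2 : d ^ 2 = Q * (Q - 4) := Real.sq_sqrt hnn
  have hd0 : 0 ≤ d := Real.sqrt_nonneg _
  -- Since Q(Q − 4) = (Q − 2)² − 4, both candidates for e^K are negative.
  have hdlt : d < Q - 2 := by
    refine lt_of_pow_lt_pow_left₀ 2 (by linarith) ?_
    rw [hd2]
    nlinarith
  rcases (exists_one_iff_of_sq (by omega) (d := (d : ℂ)) (by exact_mod_cast hd2)).1 h with h | h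
  · exact ⟨(2 - Q - d) / 2, by linarith, by rw [h]; push_cast; rfl⟩
  · exact ⟨(2 - Q + d) / 2, by linarith, by rw [h]; push_cast; rfl⟩

theorem critical (hQ : 1 ≤ Q) (h : IsPottsParam Q K r q ρ) (hc : -(ρ * q) = 1) (hρ : ρ = 1) :
    Q = 4 ∧ Complex.exp K = -1 ∧ r = -2 ∧ q = -1 ∧
      ∃ n : ℤ, K = (2 * (n : ℂ) + 1) * (Complex.I * (Real.pi : ℂ)) := by
  subst hρ
  have hq : q = -1 := by linear_combination -hc
  obtain ⟨h₁, -, h₃, h₄⟩ := (one_iff hQ).1 h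
  subst hq
  have hr : r = -2 := by
    rw [← h₃]
    norm_num
  have hK : Complex.exp K = -1 := by
    rw [h₄]
    norm_num
  refine ⟨?_, hK, hr, rfl, ?_⟩
  · rw [hr] at h₁
    have : (Q : ℂ) = 4 := by rw [← h₁]; norm_num
    exact_mod_cast this
  · rw [← Complex.exp_pi_mul_I, Complex.exp_eq_exp_iff_exists_int] at hK
    obtain ⟨n, hn⟩ := hK
    exact ⟨n, by rw [hn]; ring⟩

theorem of_critical (hK : Complex.exp K = -1) : IsPottsParam 4 K (-2) (-1) 1 := by
  refine (one_iff (by norm_num)).2 ⟨by norm_num, by norm_num, by norm_num, ?_⟩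
  rw [hK]
  norm_num

end IsPottsParam

/-! ### Assembly of the theorem -/

theorem mainTheorem2 {V E : Type*} [Fintype V] [DecidableEq V] [Fintype E] [LinearOrder E]
    (G : PlaneGraph V E) (R : Type*) [CommRing R] [IsDomain R]
    (Q : ℕ) (hQ : 1 ≤ Q) (K : ℂ) :
    -- `K(G)` is an alternating planar diagram
    (G.linkDiagram.IsPlanar ∧ G.linkDiagram.IsAlternating) ∧
    -- the Khovanov complex of `K(G)` is a bigraded complex
    ((∀ i j, (G.linkDiagram.chainGroup R i j).map (G.linkDiagram.differential R) ≤
        G.linkDiagram.chainGroup R (i + 1) j) ∧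
      G.linkDiagram.differential R ∘ₗ G.linkDiagram.differential R = 0) ∧
    -- the Potts partition function is a bracket, for either square root of `Q`
    (∀ r : ℂ, r ^ 2 = (Q : ℂ) →
      G.potts Q K =
        r ^ Fintype.card V * G.linkDiagram.bracket (r⁻¹ * (Complex.exp K - 1)) r) ∧
    -- expansion of the `ρ`-bracket over enhanced states and by generalized Euler characteristics
    (∀ q ρ : ℂ, q ≠ 0 →
      G.linkDiagram.rhoBracket q ρ =
        ∑ s : G.linkDiagram.EnhancedState, (-ρ) ^ s.nB * q ^ s.jdeg ∧
      (Function.support fun j : ℤ => G.linkDiagram.chiRho R ρ j).Finite ∧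
      G.linkDiagram.rhoBracket q ρ = ∑ᶠ j : ℤ, q ^ j * G.linkDiagram.chiRho R ρ j) ∧
    -- the change of variables is always possible, and it turns the one bracket into the other
    (∀ r : ℂ, r ^ 2 = (Q : ℂ) → ∃ q ρ, IsPottsParam Q K r q ρ) ∧
    (∀ r q ρ : ℂ, IsPottsParam Q K r q ρ →
      G.linkDiagram.bracket (r⁻¹ * (Complex.exp K - 1)) r = G.linkDiagram.rhoBracket q ρ ∧
      G.potts Q K =
        r ^ Fintype.card V * ∑ᶠ j : ℤ, q ^ j * G.linkDiagram.chiRho R ρ j ∧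
      (∃ w : ℂ, w ^ 2 = (Q : ℂ) - 4 ∧ q = (r + w) / 2 ∧ q⁻¹ = (r - w) / 2) ∧
      (∃ u : ℂ, u ^ 2 = 1 - 4 / (Q : ℂ) ∧ ρ = (Complex.exp K - 1) * ((-1 + u) / 2))) ∧
    -- the coefficients are Euler characteristics of Khovanov homology exactly when `ρ = 1`
    (∀ j, G.linkDiagram.chiRho R 1 j = (G.linkDiagram.chiHomology R j : ℂ)) ∧
    (Nonempty E → ∀ ρ : ℂ,
      (∀ j, G.linkDiagram.chiRho R ρ j = (G.linkDiagram.chiHomology R j : ℂ)) ↔ ρ = 1) ∧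
    (∀ r q : ℂ, IsPottsParam Q K r q 1 →
      G.potts Q K =
        r ^ Fintype.card V * ∑ᶠ j : ℤ, q ^ j * (G.linkDiagram.chiHomology R j : ℂ)) ∧
    -- the temperatures at which `ρ = 1`
    ((∃ r q, IsPottsParam Q K r q 1) ↔
      ∃ r w : ℂ, r ^ 2 = (Q : ℂ) ∧ w ^ 2 = (Q : ℂ) - 4 ∧
        Complex.exp K = (2 - (Q : ℂ) - r * w) / 2) ∧
    (Q = 2 → ((∃ r q, IsPottsParam Q K r q 1) ↔
      Complex.exp K = Complex.I ∨ Complex.exp K = -Complex.I)) ∧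
    (Q = 3 → ((∃ r q, IsPottsParam Q K r q 1) ↔
      Complex.exp K = (-1 + (Real.sqrt 3 : ℂ) * Complex.I) / 2 ∨
      Complex.exp K = (-1 - (Real.sqrt 3 : ℂ) * Complex.I) / 2)) ∧
    (Q = 4 → ((∃ r q, IsPottsParam Q K r q 1) ↔ Complex.exp K = -1)) ∧
    (4 < Q → (∃ r q, IsPottsParam Q K r q 1) →
      ∃ x : ℝ, x < 0 ∧ Complex.exp K = (x : ℂ)) ∧
    -- in all these cases `K = J / (kT)` and the temperature `T` are not real
    ((∃ r q, IsPottsParam Q K r q 1) →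
      K.im ≠ 0 ∧
      ∀ (J k : ℝ) (T : ℂ), (J = 1 ∨ J = -1) → 0 < k → K = (J : ℂ) / ((k : ℂ) * T) → T.im ≠ 0) ∧
    -- at criticality
    ((∃ r q ρ, IsPottsParam Q K r q ρ ∧ -(ρ * q) = 1 ∧ ρ = 1) ↔ Q = 4 ∧ Complex.exp K = -1) ∧
    (∀ r q ρ : ℂ, IsPottsParam Q K r q ρ → -(ρ * q) = 1 → ρ = 1 →
      Q = 4 ∧ Complex.exp K = -1 ∧ r = -2 ∧ q = -1 ∧
        ∃ n : ℤ, K = (2 * (n : ℂ) + 1) * (Complex.I * (Real.pi : ℂ))) := by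
  have hD := G.mergesOrSplits
  have hbracket : ∀ r : ℂ, r ^ 2 = (Q : ℂ) → G.potts Q K =
      r ^ Fintype.card V * G.linkDiagram.bracket (r⁻¹ * (Complex.exp K - 1)) r := fun r hr => by
    rw [G.potts_eq_sum, G.sum_pow_energy_eq_bracket hr (IsPottsParam.root_ne_zero hQ hr)]
  have hrho : ∀ q ρ : ℂ, q ≠ 0 → G.linkDiagram.rhoBracket q ρ =
      ∑ᶠ j : ℤ, q ^ j * G.linkDiagram.chiRho R ρ j := fun q ρ hq => by
    rw [LinkDiagram.rhoBracket_eq_sum hq, LinkDiagram.finsum_chiRho]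
  have hchange : ∀ r q ρ : ℂ, IsPottsParam Q K r q ρ →
      G.linkDiagram.bracket (r⁻¹ * (Complex.exp K - 1)) r = G.linkDiagram.rhoBracket q ρ :=
    fun r q ρ h => by rw [LinkDiagram.rhoBracket, h.site_value, h.loop_value]
  have hpotts : ∀ r q ρ : ℂ, IsPottsParam Q K r q ρ → G.potts Q K =
      r ^ Fintype.card V * ∑ᶠ j : ℤ, q ^ j * G.linkDiagram.chiRho R ρ j := fun r q ρ h => by
    rw [hbracket r h.sq_root, hchange r q ρ h, hrho q ρ h.q_ne]
  refine ⟨⟨G.isPlanar, G.isAlternating⟩, ⟨hD.map_chainGroup_le, hD.differential_comp_self⟩,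
    hbracket, ?_, fun r hr => IsPottsParam.exists_of_root K hr, ?_, hD.chiRho_one, ?_, ?_,
    IsPottsParam.exists_one_iff hQ, ?_, ?_, ?_, IsPottsParam.exists_neg_real, ?_, ?_,
    fun r q ρ h => h.critical hQ⟩
  · exact fun q ρ hq => ⟨LinkDiagram.rhoBracket_eq_sum hq ρ,
      (Finset.finite_toSet _).subset (LinkDiagram.chiRho_support_subset R _ ρ), hrho q ρ hq⟩
  · exact fun r q ρ h => ⟨hchange r q ρ h, hpotts r q ρ h, h.exists_discriminant,
      h.exists_rho hQ⟩
  · intro _ ρ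
    constructor
    · intro h
      -- Equal coefficients in every degree j give equal brackets at every q ≠ 0.
      refine G.eq_one_of_rhoBracket_eq fun q hq => ?_
      rw [hrho q ρ hq, hrho q 1 hq]
      refine finsum_congr fun j => ?_
      rw [h j, hD.chiRho_one]
    · rintro rfl
      exact hD.chiRho_one
  · intro r q h
    rw [hpotts r q 1 h]
    simp only [hD.chiRho_one]
  · rintro rfl
    -- For Q = 2 the product Q(Q − 4) is −4, with square root 2i.
    rw [IsPottsParam.exists_one_iff_of_sq hQ (d := 2 * Complex.I)
      (by rw [mul_pow, Complex.I_sq]; norm_num), or_comm]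
    refine or_congr ?_ ?_ <;> refine Eq.congr rfl ?_ <;> push_cast <;> ring
  · rintro rfl
    have h3 : ((Real.sqrt 3 : ℝ) : ℂ) ^ 2 = 3 := by
      exact_mod_cast Real.sq_sqrt (show (0 : ℝ) ≤ 3 by norm_num)
    rw [IsPottsParam.exists_one_iff_of_sq hQ (d := (Real.sqrt 3 : ℂ) * Complex.I)
      (by rw [mul_pow, Complex.I_sq, h3]; norm_num), or_comm]
    refine or_congr ?_ ?_ <;> refine Eq.congr rfl ?_ <;> push_cast <;> ring
  · rintro rfl
    rw [IsPottsParam.exists_one_iff_of_sq hQ (d := 0) (by norm_num), sub_zero, add_zero, or_self]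
    norm_num
  · rintro ⟨r, q, h⟩
    exact ⟨h.im_ne_zero hQ, fun J k T _ _ hK =>
      IsPottsParam.im_temperature_ne_zero (h.im_ne_zero hQ) hK⟩
  · constructor
    · rintro ⟨r, q, ρ, h, hc, hρ⟩
      exact ⟨(h.critical hQ hc hρ).1, (h.critical hQ hc hρ).2.1⟩
    · rintro ⟨rfl, hK⟩
      exact ⟨-2, -1, 1, IsPottsParam.of_critical hK, by norm_num, rfl⟩
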